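/- **Problems.** A *combinatorial problem* consists of instances; an instance $x$ determines a number $n$ of elements, the universe $\mathcal U=[n]$, and a family $\mathcal F\subseteq 2^{\mathcal U}$ of feasible sets. We assume that, given $x$ and $D\subseteq\mathcal U$, one can decide in polynomial time whether $D\in\mathcal F$. Each problem has two versions. *MinNorm.* Given $x$, values $v\in\mathbb R_{\ge 0}^n$ and (by a value oracle) a symmetric monotone norm $f$ on $\mathbb R^n$, i.e. a norm that is invariant under permutations of the coordinates and satisfies $f(v)\le f(u)$ whenever $0\le v\le u$. For $S\subseteq\mathcal U$ let $v[S]$ be the vector $v$ with all entries outside $S$ replaced by $0$. A $c$-approximation algorithm, $c=c(n)$, outputs some $S\in\mathcal F$ with $f(v[S])\le c\cdot\min_{S'\in\mathcal F} f(v[S'])$, or reports that $\mathcal F=\emptyset$ if this is the case. *LogBgt.* Given $x$ and pairwise disjoint sets (groups) $S_1,\dots,S_T\subseteq\mathcal U$, where $T=\lceil\log_2 n\rceil$ ($T=0$ for $n\le 1$). For $c'>0$, a set $D$ is a $c'$-valid solution if $D\in\mathcal F$, $D\subseteq S_1\cup\dots\cup S_T$, and $|D\cap S_i|\le c'\cdot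 2^i$ for all $1\le i\le T$; elements in no group are thus not available. An algorithm solves $c$-LogBgt, $c=c(n)$, if it outputs a $c$-valid solution or correctly reports that there is no $1$-valid solution. *Polynomial time* means: on a real-number machine (fixed finite program that may contain real constants; data are finite binary trees with real leaves; each arithmetic operation, comparison, elementary tree operation and oracle call costs one step), the number of steps is bounded by a polynomial in the size of the input. **Theorem.** Consider any such problem and any function $c:\mathbb N\to[1,\infty)$ (so that the factor $c=c(n)$ may depend on $n$). 1. If $c$-LogBgt can be solved in polynomial time, then for every $\varepsilon>0$ there is a polynomial-time $(4c+\varepsilon)$-approximation algorithm for MinNorm. 2. If there is a polynomial-time $c$-approximation algorithm for MinNorm (for all symmetric monotone norms $f$), then $47c^2$-LogBgt can be solved in polynomial time. -/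

import Mathlib

/-! ## The machine model

A real-number machine in the sense of Blum, Shub and Smale, presented as a small programming
language: data are finite binary trees whose leaves are real numbers, and one step is one
arithmetic operation on reals, one comparison, one pairing, one projection or one oracle call.
A program is a finite object that is fixed once and for all inputs. -/

/-- Data: binary trees with real leaves. -/
inductive RTree : Type
  | num (r : ℝ) : RTree
  | pair (a b : RTree) : RTree

namespace RTree

/-- The number of nodes of a tree, used as the size of an input. -/
def size : RTree → ℕ
  | num _ => 1
  | pair a b => a.size + b.size + 1

/-- The left subtree (`num 0` for a leaf). -/
def left : RTree → RTree
  | num _ => num 0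
  | pair a _ => a

/-- The right subtree (`num 0` for a leaf). -/
def right : RTree → RTree
  | num _ => num 0
  | pair _ b => b

/-- The number at a leaf (`0` for a tree that is not a leaf). -/
def toReal : RTree → ℝ
  | num r => r
  | pair _ _ => 0

/-- `1` for a pair, `0` for a leaf. -/
def pairTest : RTree → ℝ
  | num _ => 0
  | pair _ _ => 1

/-- A list of reals as a right comb that ends in `num 0`. -/
def ofList : List ℝ → RTree
  | [] => num 0
  | a :: l => pair (num a) (ofList l)

/-- A vector, coded as the list of its entries. -/
def ofVec {n : ℕ} (w : Fin n → ℝ) : RTree := ofList (List.ofFn w)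

/-- A set of elements, coded as its 0/1 vector. -/
def ofSet {n : ℕ} (D : Finset (Fin n)) : RTree := ofVec fun e => if e ∈ D then 1 else 0

/-- Output format of the search problems: a set, or the answer that there is none. -/
def ofAnswer {n : ℕ} : Option (Finset (Fin n)) → RTree
  | none => num 0
  | some D => pair (num 1) (ofSet D)

end RTree

/-- Programs. Each maps one tree to one tree. -/
inductive RProg : Type
  /-- return the input -/
  | id : RProg
  /-- return a real constant -/
  | const (r : ℝ) : RProg
  /-- left subtree of the input -/
  | fst : RProg
  /-- right subtree of the input -/
  | snd : RProg
  /-- run `p` and `q` on the input and pair the results -/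
  | pair (p q : RProg) : RProg
  /-- run `p`, then run `q` on its result -/
  | comp (p q : RProg) : RProg
  /-- sum of the two numbers in the input pair -/
  | add : RProg
  /-- difference of the two numbers in the input pair -/
  | sub : RProg
  /-- product of the two numbers in the input pair -/
  | mul : RProg
  /-- quotient of the two numbers in the input pair (division by zero returns zero) -/
  | div : RProg
  /-- test whether the input is a pair or a leaf -/
  | isPair : RProg
  /-- run `t`; if its result is a positive number run `p` on the input, otherwise `q` -/
  | ifPos (t p q : RProg) : RProg
  /-- while `t` returns a positive number, replace the current tree by the result of `p` -/
  | loop (t p : RProg) : RProg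
  /-- ask the oracle about the input -/
  | query : RProg

/-- `RProg.Run O p x y k`: with oracle `O`, the program `p` halts on input `x` with output `y`
after exactly `k` steps. The oracle is the graph of a partial function; the machine does not halt
if it asks a question that the oracle does not answer. -/
inductive RProg.Run (O : RTree → ℝ → Prop) : RProg → RTree → RTree → ℕ → Prop
  | id (x : RTree) : Run O .id x x 1
  | const (r : ℝ) (x : RTree) : Run O (.const r) x (.num r) 1
  | fst (x : RTree) : Run O .fst x x.left 1
  | snd (x : RTree) : Run O .snd x x.right 1
  | pair {p q : RProg} {x a b : RTree} {k l : ℕ} :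
      Run O p x a k → Run O q x b l → Run O (.pair p q) x (.pair a b) (k + l + 1)
  | comp {p q : RProg} {x y z : RTree} {k l : ℕ} :
      Run O p x y k → Run O q y z l → Run O (.comp p q) x z (k + l + 1)
  | add (x : RTree) : Run O .add x (.num (x.left.toReal + x.right.toReal)) 1
  | sub (x : RTree) : Run O .sub x (.num (x.left.toReal - x.right.toReal)) 1
  | mul (x : RTree) : Run O .mul x (.num (x.left.toReal * x.right.toReal)) 1
  | div (x : RTree) : Run O .div x (.num (x.left.toReal / x.right.toReal)) 1
  | isPair (x : RTree) : Run O .isPair x (.num x.pairTest) 1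
  | ifPos_pos {t p q : RProg} {x b y : RTree} {k l : ℕ} :
      Run O t x b k → 0 < b.toReal → Run O p x y l → Run O (.ifPos t p q) x y (k + l + 1)
  | ifPos_neg {t p q : RProg} {x b y : RTree} {k l : ℕ} :
      Run O t x b k → ¬ 0 < b.toReal → Run O q x y l → Run O (.ifPos t p q) x y (k + l + 1)
  | loop_stop {t p : RProg} {x b : RTree} {k : ℕ} :
      Run O t x b k → ¬ 0 < b.toReal → Run O (.loop t p) x x (k + 1)
  | loop_step {t p : RProg} {x b y z : RTree} {k l m : ℕ} :
      Run O t x b k → 0 < b.toReal → Run O p x y l → Run O (.loop t p) y z m →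
        Run O (.loop t p) x z (k + l + m + 1)
  | query {x : RTree} {r : ℝ} : O x r → Run O .query x (.num r) 1

/-- With oracle `O`, the program `p` halts on `x` with output `y` after at most `P (size of x)`
steps. -/
def RProg.RunsWithin (O : RTree → ℝ → Prop) (p : RProg) (P : Polynomial ℕ) (x y : RTree) : Prop :=
  ∃ k : ℕ, k ≤ P.eval x.size ∧ p.Run O x y k

/-- The oracle that answers nothing: machines without oracle. -/
def noOracle : RTree → ℝ → Prop := fun _ _ => False

/-- The value oracle of a function on `ℝⁿ`: it is asked a vector `w` and answers `f w`. -/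
def valueOracle {n : ℕ} (f : (Fin n → ℝ) → ℝ) : RTree → ℝ → Prop :=
  fun q r => ∃ w : Fin n → ℝ, q = RTree.ofVec w ∧ r = f w

/-! ## Norms -/

/-- Symmetric monotone norms on `ℝⁿ`. -/
structure IsSymmMonotoneNorm {n : ℕ} (f : (Fin n → ℝ) → ℝ) : Prop where
  nonneg : ∀ v, 0 ≤ f v
  eq_zero_iff : ∀ v, f v = 0 ↔ v = 0
  add_le : ∀ u v, f (u + v) ≤ f u + f v
  smul_eq : ∀ (θ : ℝ) (v : Fin n → ℝ), f (θ • v) = |θ| * f v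
  mono : ∀ u v : Fin n → ℝ, 0 ≤ v → v ≤ u → f v ≤ f u
  symm : ∀ (σ : Equiv.Perm (Fin n)) (v : Fin n → ℝ), f (v ∘ σ) = f v

/-- The value vector `v[S]` induced by `S`: entries outside `S` are replaced by zero. -/
def inducedVec {n : ℕ} (v : Fin n → ℝ) (S : Finset (Fin n)) : Fin n → ℝ :=
  fun e => if e ∈ S then v e else 0

/-! ## Problems -/

/-- The structure of a combinatorial problem: a set of instances, each coded by a tree `x`, and
for every instance the number `n` of elements of the universe `{0, …, n - 1}` and the family of
feasible subsets. -/
structure SubsetProblem where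
  instances : Set RTree
  card : RTree → ℕ
  feasible : (x : RTree) → Set (Finset (Fin (card x)))

namespace SubsetProblem

/-- Whether a given set is feasible can be decided in polynomial time. -/
def PolyTimeMembership (Q : SubsetProblem) : Prop :=
  ∃ (p : RProg) (P : Polynomial ℕ), ∀ x ∈ Q.instances, ∀ D : Finset (Fin (Q.card x)),
    ∃ y : RTree, p.RunsWithin noOracle P (.pair x (.ofSet D)) y ∧
      ((D ∈ Q.feasible x ∧ y = .num 1) ∨ (D ∉ Q.feasible x ∧ y = .num 0))

/-- A polynomial-time `c`-approximation for the norm minimization version, where the factor may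
depend on the number of elements. The input is the instance and the value vector; the norm is given
by its value oracle. The output is a feasible set whose norm is at most `c n` times that of every
feasible set (hence of an optimal one), or the answer that no set is feasible. -/
def MinNormPolyTimeApprox (Q : SubsetProblem) (c : ℕ → ℝ) : Prop :=
  ∃ (p : RProg) (P : Polynomial ℕ), ∀ x ∈ Q.instances,
    ∀ v : Fin (Q.card x) → ℝ, (∀ e, 0 ≤ v e) →
    ∀ f : (Fin (Q.card x) → ℝ) → ℝ, IsSymmMonotoneNorm f →
    ∃ A : Option (Finset (Fin (Q.card x))),
      p.RunsWithin (valueOracle f) P (.pair x (.ofVec v)) (.ofAnswer A) ∧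
      match A with
      | some S => S ∈ Q.feasible x ∧
          ∀ S' ∈ Q.feasible x, f (inducedVec v S) ≤ c (Q.card x) * f (inducedVec v S')
      | none => Q.feasible x = ∅

end SubsetProblem

/-- The number `⌈log₂ n⌉` of groups. -/
def numGroups (n : ℕ) : ℕ := Nat.clog 2 n

/-- The group indices of a disjoint family of groups, as a vector: `S i` is the group with index
`i + 1`, and an element outside all groups gets index `0`. -/
def groupIndex {n : ℕ} (S : Fin (numGroups n) → Finset (Fin n)) : Fin n → ℝ :=
  fun e => ∑ i, if e ∈ S i then ((i : ℕ) : ℝ) + 1 else 0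

/-- `c'`-valid solutions for feasible family `F` and groups `S` (`S i` has index `i + 1` and so
the budget `c' * 2 ^ (i + 1)`): feasible sets of grouped elements that respect all budgets. -/
def IsValidSolution {n : ℕ} (F : Set (Finset (Fin n))) (S : Fin (numGroups n) → Finset (Fin n))
    (c' : ℝ) (D : Finset (Fin n)) : Prop :=
  D ∈ F ∧ D ⊆ Finset.univ.biUnion S ∧
    ∀ i, ((D ∩ S i).card : ℝ) ≤ c' * 2 ^ ((i : ℕ) + 1)

/-- The logarithmic budgeted version with parameters `(c, c₀)` is solvable in polynomial time:
the algorithm finds a `c n`-valid solution or certifies that there is no `c₀ n`-valid one. -/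
def SubsetProblem.LogBgtPolyTime (Q : SubsetProblem) (c c₀ : ℕ → ℝ) : Prop :=
  ∃ (p : RProg) (P : Polynomial ℕ), ∀ x ∈ Q.instances,
    ∀ S : Fin (numGroups (Q.card x)) → Finset (Fin (Q.card x)),
    (∀ i j, i ≠ j → Disjoint (S i) (S j)) →
    ∃ A : Option (Finset (Fin (Q.card x))),
      p.RunsWithin noOracle P (.pair x (.ofVec (groupIndex S))) (.ofAnswer A) ∧
      match A with
      | some D => IsValidSolution (Q.feasible x) S (c (Q.card x)) D
      | none => ∀ D, ¬ IsValidSolution (Q.feasible x) S (c₀ (Q.card x)) D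

/-! The theorem relates two versions of a combinatorial problem by two reductions. Both have to be
run on the machine of the statement, so there are two tasks: to find the reductions, and to show
that programs of that machine carry them out in polynomial time.

**Programs.** `PolyComp M e f` says that one program takes `e i` to `f i` for all indices `i`, in
time polynomial in a size attached to the index `i`. The index carries all that a computation
depends on: instance, values, oracle, and in the body of a loop the loop variables. Measuring time
by the index makes the notion closed under composition, and with loops over lists
(`PolyComp.foldl_of`) it yields all list operations that are needed. Calls of the given algorithm
enter through `PolyComp.of_runsWithin`; a value oracle is replaced by a subroutine with
`RProg.Run.subst`.

**From budgets to norms.** Let `A` be an optimal set with largest value `τ`. The values are rounded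
to the levels `τ * (3 / 4) ^ k`, where logarithmically many levels suffice, and consecutive levels
are packed greedily into the groups. Which levels go into which group is described by
logarithmically many bits, so that all possibilities can be tried (`exists_candidate`); the best set
found is returned. The groups are made so that `A` is `1`-valid. A group is left behind only when
the next level does not fit, whence the budgets up to any group total at most three times the number
of elements of `A` on the levels up to it (`usedBudget_le`). So a `c`-valid set `D` has at most
`3 c` times as many elements above a level as `A` has above the next level, and by
`IsSymmMonotoneNorm.le_of_card_le` its norm is at most `3 c * (4 / 3) = 4 c` times that of `A`, up
to the contribution of the lowest level. The packing has to be greedy: if group `i` were filled up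
to the `2 ^ i`-th largest value, the factor would be `4 c` before rounding, and rounding to a factor
`1 + O(ε / c)` takes too many levels when `c` grows with `n`.

**From norms to budgets.** The elements of group `i` get value `√2 ^ (-i)`, and the norm is the
maximum of `√2 ^ (-j)` times the sum of the `2 ^ j` largest absolute values. A `1`-valid set has
norm at most `7 / 2`, and a set with `m` elements in group `i` has norm at least
`√(m / 2 ^ (i + 1))`. So an approximately optimal set is `47 c ^ 2`-valid if there is a `1`-valid
one. The norm is evaluated exactly, as the sum of the `l` largest entries is the minimum over `θ` of
the piecewise linear function `l * θ + ∑ (|w e| - θ)⁺`. The machine must also recognize when there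
is no `1`-valid set, for which it has to know `c n` up to a constant factor, or that
`47 * c n ^ 2 ≥ n`, in which case budgets do not matter. The function `c` need not be computable,
but programs may contain real constants, and the digits of one real number can hold what is needed
for all `n` (`PolyComp.advice`). -/

/-! ### Polynomially bounded functions -/

theorem Polynomial.eval_nat_mono (P : Polynomial ℕ) {a b : ℕ} (h : a ≤ b) :
    P.eval a ≤ P.eval b := by
  rw [Polynomial.eval_eq_sum_range, Polynomial.eval_eq_sum_range]
  gcongr

/-- `t` is bounded by a polynomial in the size function `N`. -/
def PolyBdd {ι : Type} (N t : ι → ℕ) : Prop := ∃ P : Polynomial ℕ, ∀ i, t i ≤ P.eval (N i)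

namespace PolyBdd

variable {ι κ : Type} {N s t : ι → ℕ}

theorem const (m : ℕ) : PolyBdd N fun _ => m := ⟨Polynomial.C m, fun i => by simp⟩

theorem self : PolyBdd N N := ⟨Polynomial.X, fun i => by simp⟩

theorem mono (ht : PolyBdd N t) (h : ∀ i, s i ≤ t i) : PolyBdd N s :=
  let ⟨P, hP⟩ := ht; ⟨P, fun i => (h i).trans (hP i)⟩

theorem add (hs : PolyBdd N s) (ht : PolyBdd N t) : PolyBdd N fun i => s i + t i := by
  obtain ⟨P, hP⟩ := hs
  obtain ⟨R, hR⟩ := ht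
  exact ⟨P + R, fun i => by simpa using add_le_add (hP i) (hR i)⟩

theorem mul (hs : PolyBdd N s) (ht : PolyBdd N t) : PolyBdd N fun i => s i * t i := by
  obtain ⟨P, hP⟩ := hs
  obtain ⟨R, hR⟩ := ht
  exact ⟨P * R, fun i => by simpa using Nat.mul_le_mul (hP i) (hR i)⟩

theorem pow (hs : PolyBdd N s) (m : ℕ) : PolyBdd N fun i => s i ^ m := by
  obtain ⟨P, hP⟩ := hs
  exact ⟨P ^ m, fun i => by simpa using Nat.pow_le_pow_left (hP i) m⟩

theorem eval (hs : PolyBdd N s) (P : Polynomial ℕ) : PolyBdd N fun i => P.eval (s i) := by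
  obtain ⟨R, hR⟩ := hs
  exact ⟨P.comp R, fun i => by simpa using P.eval_nat_mono (hR i)⟩

theorem comap (ht : PolyBdd N t) (g : κ → ι) :
    PolyBdd (fun j => N (g j)) fun j => t (g j) :=
  let ⟨P, hP⟩ := ht; ⟨P, fun j => hP (g j)⟩

end PolyBdd

/-! ### Data types and their codes -/

/-- Types whose elements are coded as trees. -/
class TreeCode (α : Type) where
  /-- The code of an element. -/
  enc : α → RTree


open TreeCode (enc)

instance : TreeCode ℝ := ⟨.num⟩
instance : TreeCode RTree := ⟨fun x => x⟩
instance : TreeCode Bool := ⟨fun b => .num (if b then 1 else 0)⟩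
instance {α β : Type} [TreeCode α] [TreeCode β] : TreeCode (α × β) :=
  ⟨fun x => .pair (enc x.1) (enc x.2)⟩

/-- Lists are right combs that end in the leaf `0`. -/
def encList {α : Type} [TreeCode α] : List α → RTree
  | [] => .num 0
  | a :: l => .pair (enc a) (encList l)

instance {α : Type} [TreeCode α] : TreeCode (List α) := ⟨encList⟩

/-- Same convention as `RTree.ofAnswer`. -/
def encOption {α : Type} [TreeCode α] : Option α → RTree
  | none => .num 0
  | some a => .pair (.num 1) (enc a)

instance {α : Type} [TreeCode α] : TreeCode (Option α) := ⟨encOption⟩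

theorem enc_list_real (l : List ℝ) : enc l = RTree.ofList l := by
  induction l with
  | nil => rfl
  | cons a l ih => exact congrArg (RTree.pair _) ih

theorem RTree.size_ofVec {n : ℕ} (w : Fin n → ℝ) : (RTree.ofVec w).size = 2 * n + 1 := by
  have h : ∀ l : List ℝ, (RTree.ofList l).size = 2 * l.length + 1 := by
    intro l
    induction l with
    | nil => rfl
    | cons a l ih => simp only [RTree.ofList, RTree.size, ih, List.length_cons]; ring
  simp [RTree.ofVec, h]

/-! ### Functions computable in polynomial time -/

theorem RProg.Run.mono_oracle {O O' : RTree → ℝ → Prop} (h : ∀ q r, O q r → O' q r) {p : RProg}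
    {x y : RTree} {k : ℕ} (hr : p.Run O x y k) : p.Run O' x y k := by
  induction hr with
  | id x => exact .id x
  | const r x => exact .const r x
  | fst x => exact .fst x
  | snd x => exact .snd x
  | pair _ _ h1 h2 => exact .pair h1 h2
  | comp _ _ h1 h2 => exact .comp h1 h2
  | add x => exact .add x
  | sub x => exact .sub x
  | mul x => exact .mul x
  | div x => exact .div x
  | isPair x => exact .isPair x
  | ifPos_pos _ hb _ h1 h2 => exact .ifPos_pos h1 hb h2
  | ifPos_neg _ hb _ h1 h2 => exact .ifPos_neg h1 hb h2
  | loop_stop _ hb h1 => exact RProg.Run.loop_stop h1 hb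
  | loop_step _ hb _ _ h1 h2 h3 => exact .loop_step h1 hb h2 h3
  | query hq => exact .query (h _ _ hq)

/-- A family of computations, indexed by `ι`: for every index an oracle, and the number that serves
as the size of the input when running times are measured. -/
structure Setting (ι : Type) where
  /-- The oracle at an index. -/
  oracle : ι → RTree → ℝ → Prop
  /-- The size at an index. -/
  size : ι → ℕ

/-- Pullback of a family of computations along a map of indices. -/
def Setting.comap {ι κ : Type} (M : Setting ι) (g : κ → ι) : Setting κ :=
  ⟨fun j => M.oracle (g j), fun j => M.size (g j)⟩

/-- `f` is computable from `e` in polynomial time: one program takes the code of `e i` to the code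
of `f i` for every index `i`, and its running time is polynomial in the size of `i`. The size is
that of the index and not that of `e i`, so that such computations compose although a program may
produce a tree of exponential size in linearly many steps. -/
def PolyComp {ι α β : Type} [TreeCode α] [TreeCode β] (M : Setting ι) (e : ι → α) (f : ι → β) :
    Prop :=
  ∃ (p : RProg) (t : ι → ℕ), PolyBdd M.size t ∧
    ∀ i, ∃ k ≤ t i, p.Run (M.oracle i) (enc (e i)) (enc (f i)) k

namespace PolyComp

variable {ι κ α β γ δ : Type} [TreeCode α] [TreeCode β] [TreeCode γ] [TreeCode δ]
  {M : Setting ι} {e : ι → α}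

theorem refl : PolyComp M e e := ⟨.id, fun _ => 1, .const 1, fun _ => ⟨1, le_rfl, .id _⟩⟩

theorem trans {f : ι → β} {g : ι → γ} (hf : PolyComp M e f) (hg : PolyComp M f g) :
    PolyComp M e g := by
  obtain ⟨p, s, hs, hp⟩ := hf
  obtain ⟨q, t, ht, hq⟩ := hg
  refine ⟨.comp p q, fun i => s i + t i + 1, (hs.add ht).add (.const 1), fun i => ?_⟩
  obtain ⟨k, hk, hr⟩ := hp i
  obtain ⟨l, hl, hr'⟩ := hq i
  exact ⟨k + l + 1, by dsimp only; omega, .comp hr hr'⟩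

theorem pair {f : ι → β} {g : ι → γ} (hf : PolyComp M e f) (hg : PolyComp M e g) :
    PolyComp M e fun i => (f i, g i) := by
  obtain ⟨p, s, hs, hp⟩ := hf
  obtain ⟨q, t, ht, hq⟩ := hg
  refine ⟨.pair p q, fun i => s i + t i + 1, (hs.add ht).add (.const 1), fun i => ?_⟩
  obtain ⟨k, hk, hr⟩ := hp i
  obtain ⟨l, hl, hr'⟩ := hq i
  exact ⟨k + l + 1, by dsimp only; omega, .pair hr hr'⟩

/-- Only the codes matter. -/
theorem congr_enc {f : ι → β} {f' : ι → γ} (hf : PolyComp M e f)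
    (h : ∀ i, enc (f i) = enc (f' i)) : PolyComp M e f' := by
  obtain ⟨p, s, hs, hp⟩ := hf
  refine ⟨p, s, hs, fun i => ?_⟩
  rw [← h i]
  exact hp i

theorem of_eq {f f' : ι → β} (hf : PolyComp M e f) (h : ∀ i, f i = f' i) : PolyComp M e f' :=
  hf.congr_enc fun i => by rw [h i]

/-- One step of the machine. -/
theorem of_step {f : ι → β} (p : RProg)
    (h : ∀ i, p.Run (M.oracle i) (enc (e i)) (enc (f i)) 1) : PolyComp M e f :=
  ⟨p, fun _ => 1, .const 1, fun i => ⟨1, le_rfl, h i⟩⟩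

theorem fst {f : ι → β × γ} (hf : PolyComp M e f) : PolyComp M e fun i => (f i).1 :=
  hf.trans (of_step .fst fun i => .fst (enc (f i)))

theorem snd {f : ι → β × γ} (hf : PolyComp M e f) : PolyComp M e fun i => (f i).2 :=
  hf.trans (of_step .snd fun i => .snd (enc (f i)))

theorem const (b : β) : PolyComp M e fun _ => b := by
  have h : ∀ x : RTree, PolyComp M e fun _ => x := by
    intro x
    induction x with
    | num r => exact of_step (.const r) fun _ => .const r _
    | pair a b ha hb => exact (ha.pair hb).congr_enc fun _ => rfl
  exact (h (enc b)).congr_enc fun _ => rfl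

theorem add {a b : ι → ℝ} (ha : PolyComp M e a) (hb : PolyComp M e b) :
    PolyComp M e fun i => a i + b i :=
  (ha.pair hb).trans (of_step .add fun i => .add (enc (a i, b i)))

theorem sub {a b : ι → ℝ} (ha : PolyComp M e a) (hb : PolyComp M e b) :
    PolyComp M e fun i => a i - b i :=
  (ha.pair hb).trans (of_step .sub fun i => .sub (enc (a i, b i)))

theorem mul {a b : ι → ℝ} (ha : PolyComp M e a) (hb : PolyComp M e b) :
    PolyComp M e fun i => a i * b i :=
  (ha.pair hb).trans (of_step .mul fun i => .mul (enc (a i, b i)))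

theorem comap {f : ι → β} (hf : PolyComp M e f) (g : κ → ι) :
    PolyComp (M.comap g) (fun j => e (g j)) fun j => f (g j) := by
  obtain ⟨p, s, hs, hp⟩ := hf
  exact ⟨p, fun j => s (g j), hs.comap g, fun j => hp (g j)⟩

/-- Case distinction, where each branch only has to work for the indices that take it. -/
theorem ite_of {a b : ι → ℝ} {f g : ι → β} [∀ i, Decidable (a i < b i)]
    (ha : PolyComp M e a) (hb : PolyComp M e b)
    (hf : PolyComp (M.comap (Subtype.val : {i // a i < b i} → ι)) (fun i => e i.1) fun i => f i.1)
    (hg : PolyComp (M.comap (Subtype.val : {i // ¬ a i < b i} → ι)) (fun i => e i.1)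
      fun i => g i.1) :
    PolyComp M e fun i => if a i < b i then f i else g i := by
  obtain ⟨t, s, hs, ht⟩ := hb.sub ha
  obtain ⟨p, s₁, ⟨P₁, hP₁⟩, hp⟩ := hf
  obtain ⟨q, s₂, ⟨P₂, hP₂⟩, hq⟩ := hg
  refine ⟨.ifPos t p q, fun i => s i + (P₁ + P₂).eval (M.size i) + 1,
    (hs.add (PolyBdd.self.eval _)).add (.const 1), fun i => ?_⟩
  obtain ⟨k, hk, hr⟩ := ht i
  simp only [Polynomial.eval_add]
  by_cases h : a i < b i
  · obtain ⟨l, hl, hr'⟩ := hp ⟨i, h⟩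
    have := hP₁ ⟨i, h⟩
    simp only [Setting.comap] at this
    refine ⟨k + l + 1, by omega, ?_⟩
    rw [if_pos h]
    exact .ifPos_pos hr (sub_pos.2 h) hr'
  · obtain ⟨l, hl, hr'⟩ := hq ⟨i, h⟩
    have := hP₂ ⟨i, h⟩
    simp only [Setting.comap] at this
    refine ⟨k + l + 1, by omega, ?_⟩
    rw [if_neg h]
    exact .ifPos_neg hr (fun h' => h (sub_pos.1 h')) hr'

theorem ite {a b : ι → ℝ} {f g : ι → β} [∀ i, Decidable (a i < b i)]
    (ha : PolyComp M e a) (hb : PolyComp M e b) (hf : PolyComp M e f) (hg : PolyComp M e g) :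
    PolyComp M e fun i => if a i < b i then f i else g i :=
  ite_of ha hb (hf.comap _) (hg.comap _)

theorem ite_le {a b : ι → ℝ} {f g : ι → β} [∀ i, Decidable (a i ≤ b i)]
    (ha : PolyComp M e a) (hb : PolyComp M e b) (hf : PolyComp M e f) (hg : PolyComp M e g) :
    PolyComp M e fun i => if a i ≤ b i then f i else g i := by
  classical
  refine (ite hb ha hg hf).of_eq fun i => ?_
  by_cases h : a i ≤ b i
  · rw [if_pos h, if_neg (not_lt.2 h)]
  · rw [if_neg h, if_pos (not_le.1 h)]

theorem max {a b : ι → ℝ} (ha : PolyComp M e a) (hb : PolyComp M e b) :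
    PolyComp M e fun i => max (a i) (b i) :=
  (ite_le ha hb hb ha).of_eq fun _ => (max_def _ _).symm

theorem min {a b : ι → ℝ} (ha : PolyComp M e a) (hb : PolyComp M e b) :
    PolyComp M e fun i => min (a i) (b i) :=
  (ite_le ha hb ha hb).of_eq fun _ => (min_def _ _).symm

theorem abs {a : ι → ℝ} (ha : PolyComp M e a) : PolyComp M e fun i => |a i| :=
  (ha.max ((const 0).sub ha)).of_eq fun i => by rw [zero_sub]; rfl

/-- A subroutine whose time is bounded in terms of the size of its own input. -/
theorem of_runsWithin {f : ι → β} {O : ι → RTree → ℝ → Prop} (p : RProg) (P : Polynomial ℕ)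
    (hO : ∀ i q r, O i q r → M.oracle i q r)
    (hsize : PolyBdd M.size fun i => (enc (e i)).size)
    (h : ∀ i, p.RunsWithin (O i) P (enc (e i)) (enc (f i))) : PolyComp M e f := by
  refine ⟨p, _, hsize.eval P, fun i => ?_⟩
  obtain ⟨k, hk, hr⟩ := h i
  exact ⟨k, hk, hr.mono_oracle (hO i)⟩

/-! ### Loops over lists -/

/-- The loop over a list. Its state is the triple of environment, remaining list and accumulator,
and `step` gets the triple of environment, accumulator and first element of the list. -/
def foldlProg (step : RProg) : RProg :=
  .loop (.comp (.comp .snd .fst) .isPair)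
    (.pair .fst (.pair (.comp .snd (.comp .fst .snd))
      (.comp (.pair .fst (.pair (.comp .snd .snd) (.comp .snd (.comp .fst .fst)))) step)))

theorem foldl_run {O : RTree → ℝ → Prop} {E : RTree} {step : RProg} {B : ℕ} (g : β → γ → β)
    (l : List γ) (s : β)
    (h : ∀ pre a post, l = pre ++ a :: post → ∃ k ≤ B, step.Run O
      (.pair E (.pair (enc (pre.foldl g s)) (enc a))) (enc (g (pre.foldl g s) a)) k) :
    ∃ k ≤ l.length * (B + 30) + 6,
      (foldlProg step).Run O (.pair E (.pair (enc l) (enc s)))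
        (.pair E (.pair (.num 0) (enc (l.foldl g s)))) k := by
  induction l generalizing s with
  | nil =>
    exact ⟨_, by norm_num,
      RProg.Run.loop_stop (.comp (.comp (.snd _) (.fst _)) (.isPair _)) (lt_irrefl 0)⟩
  | cons a l ih =>
    obtain ⟨k, hk, hr⟩ := h [] a l rfl
    obtain ⟨k', hk', hr'⟩ := ih (g s a) fun pre b post hl => h (a :: pre) b post (by rw [hl]; rfl)
    refine ⟨_, ?_, .loop_step (.comp (.comp (.snd _) (.fst _)) (.isPair _)) (zero_lt_one' ℝ)
      (.pair (.fst _) (.pair (.comp (.snd _) (.comp (.fst _) (.snd _)))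
        (.comp (.pair (.fst _) (.pair (.comp (.snd _) (.snd _))
          (.comp (.snd _) (.comp (.fst _) (.fst _))))) hr))) hr'⟩
    simp only [List.length_cons, add_mul]
    omega

/-- Loops over a list. The step has to work only for the states and elements that occur, which are
described by `R`. -/
theorem foldl_of {l : ι → List γ} {b : ι → β} {g : ι → β → γ → β} (R : ι → β → γ → Prop)
    (hlen : PolyBdd M.size fun i => (l i).length)
    (hR : ∀ i pre a post, l i = pre ++ a :: post → R i (pre.foldl (g i) (b i)) a)
    (hl : PolyComp M e l) (hb : PolyComp M e b)
    (hg : PolyComp (M.comap (fun j : {j : ι × β × γ // R j.1 j.2.1 j.2.2} => j.1.1))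
      (fun j => (e j.1.1, j.1.2)) fun j => g j.1.1 j.1.2.1 j.1.2.2) :
    PolyComp M e fun i => (l i).foldl (g i) (b i) := by
  obtain ⟨step, s, ⟨P, hP⟩, hstep⟩ := hg
  have hloop : PolyComp M (fun i => (e i, l i, b i))
      fun i => (e i, (0 : ℝ), (l i).foldl (g i) (b i)) := by
    refine ⟨foldlProg step, fun i => (l i).length * (P.eval (M.size i) + 30) + 6,
      (hlen.mul ((PolyBdd.self.eval P).add (.const _))).add (.const _), fun i => ?_⟩
    refine foldl_run (g i) (l i) (b i) fun pre a post hl => ?_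
    obtain ⟨k, hk, hr⟩ := hstep ⟨(i, _, a), hR i pre a post hl⟩
    exact ⟨k, hk.trans (hP _), hr⟩
  exact ((refl.pair (hl.pair hb)).trans hloop).snd.snd

/-- A value computed from the environment can be computed in the scope of further variables. -/
theorem lift {f : ι → β} {g : κ → ι} {x : κ → δ} (hf : PolyComp M e f) :
    PolyComp (M.comap g) (fun j => (e (g j), x j)) fun j => f (g j) :=
  (refl.fst).trans (hf.comap g)

theorem foldl {l : ι → List γ} {b : ι → β} {g : ι → β → γ → β}
    (hlen : PolyBdd M.size fun i => (l i).length)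
    (hl : PolyComp M e l) (hb : PolyComp M e b)
    (hg : PolyComp (M.comap (fun j : ι × β × γ => j.1))
      (fun j => (e j.1, j.2)) fun j => g j.1 j.2.1 j.2.2) :
    PolyComp M e fun i => (l i).foldl (g i) (b i) :=
  foldl_of (fun _ _ _ => True) hlen (fun _ _ _ _ _ => trivial) hl hb (hg.comap Subtype.val)

theorem cons {a : ι → β} {l : ι → List β} (ha : PolyComp M e a) (hl : PolyComp M e l) :
    PolyComp M e fun i => a i :: l i :=
  (ha.pair hl).congr_enc fun _ => rfl

theorem reverse {l : ι → List β} (hlen : PolyBdd M.size fun i => (l i).length)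
    (hl : PolyComp M e l) : PolyComp M e fun i => (l i).reverse := by
  refine (foldl (b := fun _ => ([] : List β)) (g := fun _ s a => a :: s) hlen hl (const [])
    (refl.snd.snd.cons refl.snd.fst)).of_eq fun i => ?_
  rw [List.foldl_flip_cons_eq_append']
  simp

theorem append {l l' : ι → List β} (hlen : PolyBdd M.size fun i => (l i).length)
    (hl : PolyComp M e l) (hl' : PolyComp M e l') : PolyComp M e fun i => l i ++ l' i := by
  refine (foldl (b := l') (g := fun _ s a => a :: s) (by simpa using hlen)
    (hl.reverse hlen) hl' (refl.snd.snd.cons refl.snd.fst)).of_eq fun i => ?_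
  rw [List.foldl_flip_cons_eq_append']
  simp

theorem map_of {l : ι → List β} {g : ι → β → γ} (R : ι → β → Prop)
    (hlen : PolyBdd M.size fun i => (l i).length) (hR : ∀ i, ∀ a ∈ l i, R i a)
    (hl : PolyComp M e l)
    (hg : PolyComp (M.comap (fun j : {j : ι × β // R j.1 j.2} => j.1.1))
      (fun j => (e j.1.1, j.1.2)) fun j => g j.1.1 j.1.2) :
    PolyComp M e fun i => (l i).map (g i) := by
  have h := foldl_of (b := fun _ => ([] : List γ)) (g := fun i s a => g i a :: s)
    (fun i _ a => R i a) hlen (fun i pre a post h => hR i a (by rw [h]; simp)) hl (const [])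
    (((refl.fst.pair refl.snd.snd).trans
      (hg.comap fun j : {j : ι × List γ × β // R j.1 j.2.2} =>
        ⟨(j.1.1, j.1.2.2), j.2⟩)).cons refl.snd.fst)
  refine (h.reverse ?_).of_eq fun i => ?_
  · refine hlen.mono fun i => le_of_eq ?_
    rw [List.foldl_flip_cons_eq_append (f := g i)]
    simp
  · rw [List.foldl_flip_cons_eq_append (f := g i)]
    simp

theorem map {l : ι → List β} {g : ι → β → γ} (hlen : PolyBdd M.size fun i => (l i).length)
    (hl : PolyComp M e l)
    (hg : PolyComp (M.comap (fun j : ι × β => j.1)) (fun j => (e j.1, j.2)) fun j => g j.1 j.2) :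
    PolyComp M e fun i => (l i).map (g i) :=
  map_of (fun _ _ => True) hlen (fun _ _ _ => trivial) hl (hg.comap Subtype.val)

theorem length {l : ι → List β} (hlen : PolyBdd M.size fun i => (l i).length)
    (hl : PolyComp M e l) : PolyComp M e fun i => ((l i).length : ℝ) := by
  refine (foldl (b := fun _ => (0 : ℝ)) (g := fun _ s _ => s + 1) hlen hl (const 0)
    (refl.snd.fst.add (const 1))).of_eq fun i => ?_
  have h : ∀ (l : List β) (s : ℝ), l.foldl (fun s _ => s + 1) s = s + l.length := by
    intro l
    induction l with
    | nil => simp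
    | cons a l ih => intro s; rw [List.foldl_cons, ih]; push_cast [List.length_cons]; ring
  rw [h, zero_add]

end PolyComp

namespace PolyComp

variable {ι κ α β γ δ : Type} [TreeCode α] [TreeCode β] [TreeCode γ] [TreeCode δ]
  {M : Setting ι} {e : ι → α}

theorem headD {l : ι → List ℝ} (hl : PolyComp M e l) : PolyComp M e fun i => (l i).headD 0 := by
  refine hl.trans (of_step .fst fun i => ?_)
  cases l i with
  | nil => exact .fst (.num 0)
  | cons a t => exact .fst (enc (a :: t))

theorem tail {l : ι → List ℝ} (hl : PolyComp M e l) : PolyComp M e fun i => (l i).tail := by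
  refine hl.trans (of_step .snd fun i => ?_)
  cases l i with
  | nil => exact .snd (.num 0)
  | cons a t => exact .snd (enc (a :: t))

theorem zipWith {l : ι → List β} {l' : ι → List ℝ} {g : ι → β → ℝ → γ}
    (hlen : PolyBdd M.size fun i => (l i).length) (heq : ∀ i, (l i).length = (l' i).length)
    (hl : PolyComp M e l) (hl' : PolyComp M e l')
    (hg : PolyComp (M.comap (fun j : ι × β × ℝ => j.1)) (fun j => (e j.1, j.2))
      fun j => g j.1 j.2.1 j.2.2) :
    PolyComp M e fun i => List.zipWith (g i) (l i) (l' i) := by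
  have h := foldl (b := fun i => (l' i, ([] : List γ)))
    (g := fun i s a => (s.1.tail, g i a (s.1.headD 0) :: s.2)) hlen hl (hl'.pair (const []))
    (refl.snd.fst.fst.tail.pair
      (((refl.fst.pair (refl.snd.snd.pair refl.snd.fst.fst.headD)).trans
        (hg.comap fun j : ι × (List ℝ × List γ) × β =>
          (j.1, j.2.2, j.2.1.1.headD 0))).cons refl.snd.fst.snd))
  have key : ∀ i (l : List β) (l' : List ℝ) (s : List γ), l.length = l'.length →
      (l.foldl (fun (s : List ℝ × List γ) a => (s.1.tail, g i a (s.1.headD 0) :: s.2))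
        (l', s)).2 = (List.zipWith (g i) l l').reverse ++ s := by
    intro i l
    induction l with
    | nil => intro l' s _; simp
    | cons a l ih =>
      intro l' s hs
      cases l' with
      | nil => simp at hs
      | cons b l' =>
        rw [List.foldl_cons, List.tail_cons, ih l' _ (by simpa using hs)]
        simp
  refine (h.snd.reverse ?_).of_eq fun i => ?_
  · refine hlen.mono fun i => ?_
    rw [key i _ _ _ (heq i)]
    simp
  · rw [key i _ _ _ (heq i)]
    simp

theorem product {l : ι → List β} {l' : ι → List γ}
    (hlen : PolyBdd M.size fun i => (l i).length) (hlen' : PolyBdd M.size fun i => (l' i).length)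
    (hl : PolyComp M e l) (hl' : PolyComp M e l') : PolyComp M e fun i => l i ×ˢ l' i := by
  refine (foldl (b := fun _ => ([] : List (β × γ)))
    (g := fun i s a => (l' i).map (Prod.mk a) ++ s) (by simpa using hlen) (hl.reverse hlen)
    (const []) ?_).of_eq fun i => ?_
  · refine append ?_ (map ?_ hl'.lift (refl.fst.snd.snd.pair refl.snd)) refl.snd.fst
    · simp only [List.length_map]
      exact hlen'.comap _
    · exact hlen'.comap _
  · rw [List.foldl_reverse]
    induction l i with
    | nil => rfl
    | cons a t ih => rw [List.foldr_cons, ih]; rfl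

/-- A question to the oracle. -/
theorem query {q : ι → β} {r : ι → ℝ} (hq : PolyComp M e q)
    (h : ∀ i, M.oracle i (enc (q i)) (r i)) : PolyComp M e r :=
  hq.trans (of_step .query fun i => .query (h i))

end PolyComp

/-- All lists of `m` bits. -/
def bitLists : ℕ → List (List Bool)
  | 0 => [[]]
  | m + 1 => (bitLists m).map (List.cons false) ++ (bitLists m).map (List.cons true)

theorem length_bitLists (m : ℕ) : (bitLists m).length = 2 ^ m := by
  induction m with
  | zero => rfl
  | succ m ih => simp [bitLists, ih, pow_succ, mul_two]

theorem mem_bitLists {m : ℕ} {b : List Bool} (h : b.length = m) : b ∈ bitLists m := by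
  induction b generalizing m with
  | nil => subst h; simp [bitLists]
  | cons a b ih =>
    subst h
    cases a <;> simp [bitLists, ih rfl]

theorem length_of_mem_bitLists {m : ℕ} {b : List Bool} (h : b ∈ bitLists m) : b.length = m := by
  induction m generalizing b with
  | zero => simp [bitLists] at h; simp [h]
  | succ m ih =>
    rcases List.mem_append.1 h with h | h <;> obtain ⟨t, ht, rfl⟩ := List.mem_map.1 h <;>
      simp [ih ht]

theorem clog_foldl (n : ℕ) {γ : Type} (l : List γ) :
    l.foldl (fun (s : ℝ × List ℝ) _ => if s.1 < n then (2 * s.1, 0 :: s.2) else s) (1, []) =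
      (2 ^ min l.length (Nat.clog 2 n), List.replicate (min l.length (Nat.clog 2 n)) 0) := by
  induction l using List.reverseRecOn with
  | nil => simp
  | append_singleton l a ih =>
    rw [List.foldl_append, ih, List.length_append, List.length_singleton]
    simp only [List.foldl_cons, List.foldl_nil]
    by_cases h : l.length < Nat.clog 2 n
    · have h2 : (2 : ℝ) ^ l.length < n := by
        exact_mod_cast (Nat.lt_clog_iff_pow_lt one_lt_two).1 h
      rw [min_eq_left h.le, min_eq_left h, if_pos h2, pow_succ, mul_comm, List.replicate_succ]
    · have h2 : ¬ (2 : ℝ) ^ Nat.clog 2 n < n := by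
        rw [not_lt]
        exact_mod_cast Nat.le_pow_clog one_lt_two n
      rw [min_eq_right (not_lt.1 h), min_eq_right (by omega), if_neg h2]

theorem Nat.clog_two_le (n : ℕ) : Nat.clog 2 n ≤ n :=
  Nat.clog_le_of_le_pow Nat.lt_two_pow_self.le

theorem Nat.two_pow_clog_le (n : ℕ) : 2 ^ Nat.clog 2 n ≤ 2 * n + 1 := by
  rcases Nat.eq_zero_or_pos (Nat.clog 2 n) with h | h
  · rw [h]; omega
  · have := (Nat.lt_clog_iff_pow_lt (b := 2) one_lt_two (x := n) (y := Nat.clog 2 n - 1)).1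
      (by omega)
    obtain ⟨m, hm⟩ : ∃ m, Nat.clog 2 n = m + 1 := ⟨_, (Nat.succ_pred_eq_of_pos h).symm⟩
    rw [hm] at this ⊢
    rw [pow_succ]
    simp only [Nat.add_sub_cancel] at this
    omega

namespace PolyComp

variable {ι α β γ : Type} [TreeCode α] [TreeCode β] [TreeCode γ] {M : Setting ι} {e : ι → α}

theorem bitLists {l : ι → List β} (hlen : PolyBdd M.size fun i => 2 ^ (l i).length)
    (hl : PolyComp M e l) : PolyComp M e fun i => bitLists (l i).length := by
  have key : ∀ l : List β, l.foldl (fun (s : List (List Bool)) _ =>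
      s.map (List.cons false) ++ s.map (List.cons true)) [[]] = _root_.bitLists l.length := by
    intro l
    induction l using List.reverseRecOn with
    | nil => rfl
    | append_singleton l a ih =>
      rw [List.foldl_append, ih, List.length_append, List.length_singleton]
      rfl
  have hbd : PolyBdd (M.comap (fun j : {j : ι × List (List Bool) × β //
      j.2.1.length ≤ 2 ^ (l j.1).length} => j.1.1)).size fun j => j.1.2.1.length :=
    (hlen.comap _).mono fun j => j.2
  refine (foldl_of (b := fun _ => [[]])
    (g := fun _ s _ => s.map (List.cons false) ++ s.map (List.cons true))
    (fun i s _ => s.length ≤ 2 ^ (l i).length) (hlen.mono fun i => Nat.lt_two_pow_self.le)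
    (fun i pre a post h => ?_) hl (const _) ?_).of_eq fun i => key (l i)
  · rw [key, length_bitLists, h, List.length_append]
    exact Nat.pow_le_pow_right two_pos (Nat.le_add_right _ _)
  · exact append (by simpa using hbd)
      (map hbd refl.snd.fst ((const false).cons refl.snd))
      (map hbd refl.snd.fst ((const true).cons refl.snd))

/-- A list of length `⌈log₂ n⌉`, computed from a list of length `n`. -/
theorem clogList {l : ι → List β} (hlen : PolyBdd M.size fun i => (l i).length)
    (hl : PolyComp M e l) :
    PolyComp M e fun i => List.replicate (Nat.clog 2 (l i).length) (0 : ℝ) := by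
  refine (foldl (b := fun _ => ((1 : ℝ), ([] : List ℝ)))
    (g := fun i s _ => if s.1 < ((l i).length : ℝ) then (2 * s.1, 0 :: s.2) else s) hlen hl
    (const _) (ite refl.snd.fst.fst (hl.length hlen).lift
      (((const 2).mul refl.snd.fst.fst).pair ((const 0).cons refl.snd.fst.snd))
      refl.snd.fst)).snd.of_eq fun i => ?_
  rw [clog_foldl, min_eq_right (Nat.clog_two_le _)]

end PolyComp

/-- Replaces the questions to the oracle by a subroutine. -/
def RProg.subst : RProg → RProg → RProg
  | .id, _ => .id
  | .const r, _ => .const r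
  | .fst, _ => .fst
  | .snd, _ => .snd
  | .pair p q, s => .pair (p.subst s) (q.subst s)
  | .comp p q, s => .comp (p.subst s) (q.subst s)
  | .add, _ => .add
  | .sub, _ => .sub
  | .mul, _ => .mul
  | .div, _ => .div
  | .isPair, _ => .isPair
  | .ifPos t p q, s => .ifPos (t.subst s) (p.subst s) (q.subst s)
  | .loop t p, s => .loop (t.subst s) (p.subst s)
  | .query, s => s

theorem RProg.Run.subst {O O' : RTree → ℝ → Prop} {s : RProg} {B : ℕ}
    (h : ∀ q r, O q r → ∃ k ≤ B, s.Run O' q (.num r) k) {p : RProg} {x y : RTree} {k : ℕ}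
    (hr : p.Run O x y k) : ∃ k' ≤ k * (B + 1), (p.subst s).Run O' x y k' := by
  induction hr with
  | id x => exact ⟨1, by omega, .id x⟩
  | const r x => exact ⟨1, by omega, .const r x⟩
  | fst x => exact ⟨1, by omega, .fst x⟩
  | snd x => exact ⟨1, by omega, .snd x⟩
  | pair _ _ h1 h2 =>
    obtain ⟨a, ha, ra⟩ := h1
    obtain ⟨b, hb, rb⟩ := h2
    exact ⟨a + b + 1, by simp only [add_mul] at *; omega, .pair ra rb⟩
  | comp _ _ h1 h2 =>
    obtain ⟨a, ha, ra⟩ := h1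
    obtain ⟨b, hb, rb⟩ := h2
    exact ⟨a + b + 1, by simp only [add_mul] at *; omega, .comp ra rb⟩
  | add x => exact ⟨1, by omega, .add x⟩
  | sub x => exact ⟨1, by omega, .sub x⟩
  | mul x => exact ⟨1, by omega, .mul x⟩
  | div x => exact ⟨1, by omega, .div x⟩
  | isPair x => exact ⟨1, by omega, .isPair x⟩
  | ifPos_pos _ hb _ h1 h2 =>
    obtain ⟨a, ha, ra⟩ := h1
    obtain ⟨b, hb', rb⟩ := h2
    exact ⟨a + b + 1, by simp only [add_mul] at *; omega, .ifPos_pos ra hb rb⟩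
  | ifPos_neg _ hb _ h1 h2 =>
    obtain ⟨a, ha, ra⟩ := h1
    obtain ⟨b, hb', rb⟩ := h2
    exact ⟨a + b + 1, by simp only [add_mul] at *; omega, .ifPos_neg ra hb rb⟩
  | loop_stop _ hb h1 =>
    obtain ⟨a, ha, ra⟩ := h1
    exact ⟨a + 1, by simp only [add_mul] at *; omega, RProg.Run.loop_stop ra hb⟩
  | loop_step _ hb _ _ h1 h2 h3 =>
    obtain ⟨a, ha, ra⟩ := h1
    obtain ⟨b, hb', rb⟩ := h2
    obtain ⟨c, hc, rc⟩ := h3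
    exact ⟨a + b + c + 1, by simp only [add_mul] at *; omega, .loop_step ra hb rb rc⟩
  | query hq =>
    obtain ⟨a, ha, ra⟩ := h _ _ hq
    exact ⟨a, by omega, ra⟩

/-! ### Comparing symmetric monotone norms by counting -/

namespace IsSymmMonotoneNorm

variable {n : ℕ} {f : (Fin n → ℝ) → ℝ}

theorem zero (hf : IsSymmMonotoneNorm f) : f 0 = 0 := (hf.eq_zero_iff 0).2 rfl

theorem sum_le (hf : IsSymmMonotoneNorm f) {κ : Type} (s : Finset κ) (u : κ → Fin n → ℝ) :
    f (∑ r ∈ s, u r) ≤ ∑ r ∈ s, f (u r) :=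
  Finset.le_sum_of_subadditive f hf.zero.le hf.add_le s u

end IsSymmMonotoneNorm

/-- For each `r` the map `i ↦ (p * i + r) / q` is injective as `q ≤ p`, so that it extends to a
permutation, where defined. -/
theorem exists_perm_div (n p q r : ℕ) (hq : 0 < q) (hqp : q ≤ p) :
    ∃ π : Equiv.Perm (Fin n), ∀ i j : Fin n, (p * i + r) / q = j → π i = j := by
  classical
  have hinj : ∀ a b : ℕ, a < b → (p * a + r) / q < (p * b + r) / q := by
    intro a b hab
    have h1 : p * a + r + q ≤ p * b + r := by
      have := Nat.mul_le_mul_left p (Nat.succ_le_of_lt hab)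
      rw [Nat.mul_succ] at this
      omega
    calc (p * a + r) / q < (p * a + r) / q + 1 := Nat.lt_succ_self _
      _ = (p * a + r + q) / q := (Nat.add_div_right _ hq).symm
      _ ≤ _ := Nat.div_le_div_right h1
  let φ : Fin n → Fin n := fun i => if h : (p * i + r) / q < n then ⟨_, h⟩ else i
  have hφ : ∀ i : Fin n, (p * i + r) / q < n → ((φ i : Fin n) : ℕ) = (p * i + r) / q := by
    intro i hi
    simp [φ, hi]
  obtain ⟨g, hg⟩ := Finset.exists_equiv_extend_of_card_eq (α := Fin n)
    (t := (Finset.univ : Finset (Fin n))) (by simp)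
    (s := Finset.univ.filter fun i : Fin n => (p * i + r) / q < n) (f := φ) (Finset.subset_univ _)
    (by
      intro a ha b hb hab
      simp only [Finset.coe_filter, Finset.mem_univ, true_and, Set.mem_ofPred_eq] at ha hb
      have h2 := congrArg Fin.val hab
      rw [hφ a ha, hφ b hb] at h2
      rcases lt_trichotomy (a : ℕ) b with h | h | h
      · exact absurd h2 (hinj _ _ h).ne
      · exact Fin.ext h
      · exact absurd h2 (hinj _ _ h).ne')
  refine ⟨g.trans (Equiv.subtypeUnivEquiv (fun x => Finset.mem_univ x)), fun i j hij => ?_⟩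
  have hlt : (p * i + r) / q < n := hij ▸ j.2
  have h1 := hg i (by simpa using hlt)
  refine Fin.ext ?_
  rw [← hij, ← hφ i hlt, ← h1]
  rfl

theorem card_filter_le_comp {n : ℕ} (u : Fin n → ℝ) (σ : Equiv.Perm (Fin n)) (θ : ℝ) :
    (Finset.univ.filter fun e => θ ≤ (u ∘ σ) e).card = (Finset.univ.filter fun e => θ ≤ u e).card :=
  Finset.card_equiv σ fun e => by simp

namespace IsSymmMonotoneNorm

variable {n : ℕ} {f : (Fin n → ℝ) → ℝ}

/-- With both vectors sorted, position `j` of `u`, repeated `q` times, takes the slots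
`q * j, …, q * j + q - 1`, and position `i` of `w`, repeated `p` times, the slots
`p * i, …, p * i + p - 1`. By the hypothesis the entry of `w` in a slot is at least that of `u`.
So `q • u` is dominated by a sum of `p` rearrangements of `w`. -/
theorem mul_le_of_antitone (hf : IsSymmMonotoneNorm f) {u w : Fin n → ℝ} (hu : 0 ≤ u) (hw : 0 ≤ w)
    (hua : Antitone u) (hwa : Antitone w) {p q : ℕ} (hq : 0 < q) (hqp : q ≤ p)
    (h : ∀ θ : ℝ, 0 < θ → q * (Finset.univ.filter fun e => θ ≤ u e).card ≤
      p * (Finset.univ.filter fun e => θ ≤ w e).card) : q * f u ≤ p * f w := by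
  choose π hπ using fun r => exists_perm_div n p q r hq hqp
  have hp : 0 < p := hq.trans_le hqp
  have hdom : (q : ℝ) • u ≤ ∑ r ∈ Finset.range p, w ∘ (π r).symm := by
    intro j
    rw [Finset.sum_apply, Pi.smul_apply, smul_eq_mul]
    rcases (hu j).eq_or_lt with h0 | h0
    · rw [← h0, Pi.zero_apply, mul_zero]
      exact Finset.sum_nonneg fun r _ => hw _
    have hcu : (j : ℕ) + 1 ≤ (Finset.univ.filter fun e => u j ≤ u e).card := by
      rw [← Fin.card_Iic j]
      refine Finset.card_le_card fun e he => ?_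
      simpa using hua (Finset.mem_Iic.1 he)
    have hslot : ∀ s < q, u j ≤ w ((π ((q * j + s) % p)).symm j) := by
      intro s hs
      have hi : (q * j + s) / p < (Finset.univ.filter fun e => u j ≤ w e).card := by
        rw [Nat.div_lt_iff_lt_mul hp, mul_comm _ p]
        calc q * j + s < q * (j + 1) := by rw [Nat.mul_succ]; omega
          _ ≤ _ := (Nat.mul_le_mul_left q hcu).trans (h _ h0)
      have hin : (q * j + s) / p < n := by
        have := (Finset.univ.filter fun e => u j ≤ w e).card_le_univ
        rw [Fintype.card_fin] at this
        omega
      have hπi : (π ((q * j + s) % p)).symm j = ⟨(q * j + s) / p, hin⟩ := by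
        rw [Equiv.symm_apply_eq]
        symm
        apply hπ
        dsimp only
        rw [Nat.div_add_mod, Nat.mul_add_div hq, Nat.div_eq_of_lt hs, add_zero]
      rw [hπi]
      by_contra hlt
      have : (Finset.univ.filter fun e => u j ≤ w e).card ≤ (q * j + s) / p := by
        refine le_of_le_of_eq ?_ (Fin.card_Iio (⟨(q * j + s) / p, hin⟩ : Fin n))
        refine Finset.card_le_card fun e he => ?_
        simp only [Finset.mem_filter, Finset.mem_univ, true_and] at he
        rw [Finset.mem_Iio]
        by_contra hle
        exact hlt (he.trans (hwa (not_lt.1 hle)))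
      omega
    calc (q : ℝ) * u j = ∑ s ∈ Finset.range q, u j := by simp
      _ ≤ ∑ s ∈ Finset.range q, w ((π ((q * j + s) % p)).symm j) :=
        Finset.sum_le_sum fun s hs => hslot s (Finset.mem_range.1 hs)
      _ = ∑ r ∈ (Finset.range q).image (fun s => (q * j + s) % p), w ((π r).symm j) := by
        rw [Finset.sum_image]
        intro a ha b hb hab
        have ha' := Finset.mem_range.1 ha
        have hb' := Finset.mem_range.1 hb
        exact Nat.ModEq.eq_of_lt_of_lt (Nat.ModEq.add_left_cancel' (q * j) hab)
          (ha'.trans_le hqp) (hb'.trans_le hqp)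
      _ ≤ ∑ r ∈ Finset.range p, w ((π r).symm j) := by
        refine Finset.sum_le_sum_of_subset_of_nonneg ?_ fun r _ _ => hw _
        intro r hr
        obtain ⟨s, -, rfl⟩ := Finset.mem_image.1 hr
        exact Finset.mem_range.2 (Nat.mod_lt _ hp)
      _ = _ := rfl
  calc (q : ℝ) * f u = f ((q : ℝ) • u) := by rw [hf.smul_eq, Nat.abs_cast]
    _ ≤ f (∑ r ∈ Finset.range p, w ∘ (π r).symm) :=
      hf.mono _ _ (smul_nonneg (Nat.cast_nonneg q) hu) hdom
    _ ≤ ∑ r ∈ Finset.range p, f (w ∘ (π r).symm) := hf.sum_le _ _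
    _ = p * f w := by simp [hf.symm]

theorem le_of_card_le (hf : IsSymmMonotoneNorm f) {u w : Fin n → ℝ} (hu : 0 ≤ u) (hw : 0 ≤ w)
    {C : ℝ} (hC : 1 ≤ C) (h : ∀ θ : ℝ, 0 < θ → ((Finset.univ.filter fun e => θ ≤ u e).card : ℝ) ≤
      C * (Finset.univ.filter fun e => θ ≤ w e).card) : f u ≤ C * f w := by
  have hsort : ∀ u : Fin n → ℝ, ∃ σ : Equiv.Perm (Fin n), Antitone (u ∘ σ) := by
    intro u
    refine ⟨Tuple.sort (-u), fun i j hij => ?_⟩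
    have := Tuple.monotone_sort (-u) hij
    simpa using this
  obtain ⟨σ, hσ⟩ := hsort u
  obtain ⟨ρ, hρ⟩ := hsort w
  have hrat : ∀ x : ℚ, C < x → f u ≤ x * f w := by
    intro x hx
    have hx1 : (1 : ℚ) < x := by exact_mod_cast hC.trans_lt hx
    have hnum : (x.num.toNat : ℤ) = x.num := Int.toNat_of_nonneg (Rat.num_pos.2 (by linarith)).le
    have hxe : (x : ℝ) = (x.num.toNat : ℝ) / x.den := by
      rw [Rat.cast_def]
      congr 1
      exact_mod_cast hnum.symm
    have hden : (0 : ℝ) < x.den := by exact_mod_cast x.den_pos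
    have key := hf.mul_le_of_antitone (u := u ∘ σ) (w := w ∘ ρ) (fun e => hu (σ e))
      (fun e => hw (ρ e)) hσ hρ (p := x.num.toNat) (q := x.den) x.den_pos ?_ ?_
    · rw [hf.symm, hf.symm] at key
      rw [hxe, div_mul_eq_mul_div, le_div_iff₀ hden]
      linarith
    · have : (1 : ℝ) < (x.num.toNat : ℝ) / x.den := by rw [← hxe]; exact_mod_cast hx1
      rw [one_lt_div hden] at this
      exact_mod_cast this.le
    · intro θ hθ
      rw [card_filter_le_comp, card_filter_le_comp]
      have h1 := (h θ hθ).trans (mul_le_mul_of_nonneg_right hx.le (Nat.cast_nonneg _))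
      rw [hxe, div_mul_eq_mul_div, le_div_iff₀ hden, mul_comm] at h1
      exact_mod_cast h1
  have hw0 := hf.nonneg w
  refine le_of_forall_pos_le_add fun ε hε => ?_
  obtain ⟨x, hx1, hx2⟩ := exists_rat_btwn (lt_add_of_pos_right C (div_pos hε
    (by linarith : 0 < f w + 1)))
  refine (hrat x hx1).trans ((mul_le_mul_of_nonneg_right hx2.le hw0).trans ?_)
  rw [add_mul]
  gcongr
  rw [div_mul_eq_mul_div, div_le_iff₀ (by linarith)]
  nlinarith

end IsSymmMonotoneNorm

/-! ### Greedy packing of value levels into groups -/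

/-- `N k` is the number of elements on the levels below `k`. The levels are packed into groups
greedily, and `greedyCut N K i` is the first level of group `i`, which has room for `2 ^ (i + 1)`
elements. A group stays empty if its first level is too large. -/
def greedyCut (N : ℕ → ℕ) (K : ℕ) : ℕ → ℕ
  | 0 => 0
  | i + 1 => Nat.findGreatest (fun k => N k ≤ N (greedyCut N K i) + 2 ^ (i + 1)) K

/-- The total budget of the nonempty ones among the groups below `i`. -/
def usedBudget (N : ℕ → ℕ) (K i : ℕ) : ℕ :=
  ∑ j ∈ Finset.range i, if greedyCut N K j < greedyCut N K (j + 1) then 2 ^ (j + 1) else 0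

section Greedy

variable {N : ℕ → ℕ} {K : ℕ}

theorem greedyCut_le (i : ℕ) : greedyCut N K i ≤ K := by
  cases i with
  | zero => exact Nat.zero_le _
  | succ i => exact Nat.findGreatest_le _

theorem greedyCut_le_succ (i : ℕ) : greedyCut N K i ≤ greedyCut N K (i + 1) :=
  Nat.le_findGreatest (greedyCut_le i) (Nat.le_add_right _ _)

theorem greedyCut_mono : Monotone (greedyCut N K) := monotone_nat_of_le_succ greedyCut_le_succ

theorem apply_greedyCut_succ_le (i : ℕ) :
    N (greedyCut N K (i + 1)) ≤ N (greedyCut N K i) + 2 ^ (i + 1) :=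
  Nat.findGreatest_spec (P := fun k => N k ≤ N (greedyCut N K i) + 2 ^ (i + 1)) (greedyCut_le i)
    (Nat.le_add_right _ _)

theorem lt_apply_greedyCut_succ_add_one {i : ℕ} (h : greedyCut N K (i + 1) < K) :
    N (greedyCut N K i) + 2 ^ (i + 1) < N (greedyCut N K (i + 1) + 1) :=
  not_le.1 (Nat.findGreatest_is_greatest (P := fun k => N k ≤ N (greedyCut N K i) + 2 ^ (i + 1))
    (Nat.lt_succ_self _) h)

/-- A nonempty group together with its predecessor costs `3 * 2 ^ i`, and it is only opened
because more than `2 ^ i` elements did not fit into the predecessor. -/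
theorem usedBudget_le (hN : Monotone N) (h1 : 1 ≤ N 1) (i : ℕ) :
    usedBudget N K i ≤ 3 * N (greedyCut N K i) ∧
      (greedyCut N K i < K → 2 ^ (i + 1) + usedBudget N K i ≤ 3 * N (greedyCut N K i + 1)) := by
  induction i with
  | zero => norm_num [usedBudget, greedyCut]; omega
  | succ i ih =>
    obtain ⟨ihB, ihC⟩ := ih
    have hs : usedBudget N K (i + 1) = usedBudget N K i +
        if greedyCut N K i < greedyCut N K (i + 1) then 2 ^ (i + 1) else 0 :=
      Finset.sum_range_succ _ _
    constructor
    · rw [hs]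
      split_ifs with h
      · have h2 := ihC (h.trans_le (greedyCut_le _))
        have h3 := hN (Nat.succ_le_of_lt h)
        simp only [Nat.succ_eq_add_one] at h3
        omega
      · have := hN (greedyCut_le_succ (N := N) (K := K) i)
        omega
    · intro h
      have h2 := lt_apply_greedyCut_succ_add_one h
      have h3 : (if greedyCut N K i < greedyCut N K (i + 1) then 2 ^ (i + 1) else 0) ≤
          2 ^ (i + 1) := by
        split_ifs
        exacts [le_rfl, Nat.zero_le _]
      have h4 : 2 ^ (i + 1 + 1) = 2 * 2 ^ (i + 1) := by ring
      omega

end Greedy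

theorem lt_card_filter_range_iff {T i : ℕ} {p : ℕ → Prop} [DecidablePred p] (hi : i < T)
    (hp : ∀ a b, a ≤ b → p b → p a) : i < ((Finset.range T).filter p).card ↔ p i := by
  constructor
  · intro h
    by_contra hpi
    have : ((Finset.range T).filter p).card ≤ (Finset.range i).card := by
      refine Finset.card_le_card fun j hj => ?_
      rw [Finset.mem_filter] at hj
      rw [Finset.mem_range]
      by_contra hij
      exact hpi (hp _ _ (not_lt.1 hij) hj.2)
    rw [Finset.card_range] at this
    omega
  · intro h
    have : (Finset.range (i + 1)).card ≤ ((Finset.range T).filter p).card := by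
      refine Finset.card_le_card fun j hj => ?_
      rw [Finset.mem_range] at hj
      exact Finset.mem_filter.2 ⟨Finset.mem_range.2 (by omega), hp _ _ (by omega) h⟩
    rw [Finset.card_range] at this
    omega

/-! ### A good grouping for an optimal set -/

section Grouping

variable {n : ℕ}

/-- The number of elements of `A` with value above the level `τ * (3 / 4) ^ k`. -/
noncomputable def countAbove (v : Fin n → ℝ) (A : Finset (Fin n)) (τ : ℝ) (k : ℕ) : ℕ :=
  (A.filter fun e => τ * (3 / 4) ^ k < v e).card

/-- The group (counted from `1`) that the greedy packing of the levels of `A` assigns to an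
element; `0` if its value exceeds `τ`. -/
noncomputable def greedyGroup (v : Fin n → ℝ) (A : Finset (Fin n)) (τ : ℝ) (K T : ℕ) (e : Fin n) :
    ℕ :=
  ((Finset.range T).filter fun i => v e ≤ τ * (3 / 4) ^ greedyCut (countAbove v A τ) K i).card

variable {v : Fin n → ℝ} {A : Finset (Fin n)} {τ : ℝ} {K T : ℕ}

theorem level_anti (hτ : 0 ≤ τ) {a b : ℕ} (h : a ≤ b) : τ * (3 / 4 : ℝ) ^ b ≤ τ * (3 / 4) ^ a :=
  mul_le_mul_of_nonneg_left (pow_le_pow_of_le_one (by norm_num) (by norm_num) h) hτ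

theorem countAbove_mono (hτ : 0 ≤ τ) : Monotone (countAbove v A τ) := fun _ _ h =>
  Finset.card_le_card (Finset.monotone_filter_right _ fun _ _ he => (level_anti hτ h).trans_lt he)

theorem lt_greedyGroup_iff (hτ : 0 ≤ τ) {i : ℕ} (hi : i < T) (e : Fin n) :
    i < greedyGroup v A τ K T e ↔ v e ≤ τ * (3 / 4) ^ greedyCut (countAbove v A τ) K i :=
  lt_card_filter_range_iff hi fun _ _ hab h => h.trans (level_anti hτ (greedyCut_mono hab))

theorem greedyGroup_le (e : Fin n) : greedyGroup v A τ K T e ≤ T :=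
  (Finset.card_filter_le _ _).trans (Finset.card_range T).le

theorem greedyGroup_pos (hτ : 0 ≤ τ) (hT : 0 < T) {e : Fin n} (he : v e ≤ τ) :
    0 < greedyGroup v A τ K T e :=
  (lt_greedyGroup_iff hτ hT e).2 (by simpa [greedyCut] using he)

/-- The set that the groups were made for respects all budgets. The last group has room for
everything. -/
theorem card_greedyGroup_le (hτ : 0 ≤ τ) (hn : n ≤ 2 ^ T) {i : ℕ} (hi : i < T) :
    (A.filter fun e => greedyGroup v A τ K T e = i + 1).card ≤ 2 ^ (i + 1) := by
  set h := greedyCut (countAbove v A τ) K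
  by_cases hi' : i + 1 < T
  · have hsub : (A.filter fun e => greedyGroup v A τ K T e = i + 1) ⊆
        (A.filter fun e => τ * (3 / 4) ^ h (i + 1) < v e) \
          A.filter fun e => τ * (3 / 4) ^ h i < v e := by
      intro e he
      rw [Finset.mem_filter] at he
      have h1 := (lt_greedyGroup_iff (v := v) (A := A) (K := K) hτ hi e).1 (by omega)
      have h2 := (lt_greedyGroup_iff (v := v) (A := A) (K := K) hτ hi' e).not.1 (by omega)
      simp only [Finset.mem_sdiff, Finset.mem_filter, not_and, not_lt]
      exact ⟨⟨he.1, not_le.1 h2⟩, fun _ => h1⟩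
    refine (Finset.card_le_card hsub).trans ?_
    rw [Finset.card_sdiff_of_subset
      (Finset.monotone_filter_right _ fun e _ he =>
        (level_anti hτ (greedyCut_le_succ i)).trans_lt he)]
    have := apply_greedyCut_succ_le (N := countAbove v A τ) (K := K) i
    exact tsub_le_iff_left.2 this
  · obtain rfl : T = i + 1 := by omega
    exact (Finset.card_le_univ _).trans (by simpa using hn)

/-- The elements of `D` in the groups up to `i`: groups that received no level are empty. -/
theorem card_le_usedBudget (hτ : 0 ≤ τ) {c : ℝ} {D : Finset (Fin n)}
    (hD : ∀ e ∈ D, 0 < greedyGroup v A τ K T e)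
    (hcard : ∀ i < T, ((D.filter fun e => greedyGroup v A τ K T e = i + 1).card : ℝ) ≤
      c * 2 ^ (i + 1)) {i : ℕ} (hi : i < T) :
    ((D.filter fun e => greedyGroup v A τ K T e ≤ i + 1).card : ℝ) ≤
      c * ((2 ^ (i + 1) + usedBudget (countAbove v A τ) K i : ℕ) : ℝ) := by
  set g := greedyGroup v A τ K T
  set h := greedyCut (countAbove v A τ) K
  have hsub : D.filter (fun e => g e ≤ i + 1) ⊆
      (Finset.range (i + 1)).biUnion fun j => D.filter fun e => g e = j + 1 := by
    intro e he
    rw [Finset.mem_filter] at he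
    have := hD e he.1
    exact Finset.mem_biUnion.2 ⟨g e - 1, Finset.mem_range.2 (by omega),
      Finset.mem_filter.2 ⟨he.1, by omega⟩⟩
  have hle : ((D.filter fun e => g e ≤ i + 1).card : ℝ) ≤
      ∑ j ∈ Finset.range (i + 1), ((D.filter fun e => g e = j + 1).card : ℝ) := by
    exact_mod_cast (Finset.card_le_card hsub).trans Finset.card_biUnion_le
  refine hle.trans ?_
  rw [Finset.sum_range_succ, usedBudget, Nat.cast_add, Nat.cast_sum, mul_add, Finset.mul_sum,
    add_comm]
  refine add_le_add ((hcard i hi).trans_eq (by push_cast; rfl)) (Finset.sum_le_sum fun j hj => ?_)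
  rw [Finset.mem_range] at hj
  split_ifs with hlt
  · exact (hcard j (by omega)).trans_eq (by push_cast; rfl)
  · have heq : h j = h (j + 1) := le_antisymm (greedyCut_le_succ j) (not_lt.1 hlt)
    have : D.filter (fun e => g e = j + 1) = ∅ := by
      refine Finset.filter_eq_empty_iff.2 fun e _ he => ?_
      have h1 := (lt_greedyGroup_iff (v := v) (A := A) (K := K) hτ (by omega : j < T) e).1
        (by change j < g e; omega)
      have h2 := (lt_greedyGroup_iff (v := v) (A := A) (K := K) hτ (by omega : j + 1 < T) e).not.1
        (by change ¬ j + 1 < g e; omega)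
      change v e ≤ τ * (3 / 4) ^ h j at h1
      rw [heq] at h1
      exact h2 h1
    simp [this]

/-- A set that exceeds the budgets of the groups made for `A` at most by the factor `c` has norm at
most `4 c + ε` times that of `A`. The number of its elements above a given level is at most `3 c`
times the number of elements of `A` above the next level; this gives `3 c * (4 / 3)` for the levels
above `K`, and the remaining elements have values so small that they cost `ε` at most. -/
theorem norm_le_of_greedyGroup {f : (Fin n → ℝ) → ℝ} (hf : IsSymmMonotoneNorm f)
    (hv : ∀ e, 0 ≤ v e) (hτ : τ = 0 ∨ ∃ e ∈ A, v e = τ)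
    {ε : ℝ} (hK : n * (3 / 4 : ℝ) ^ K ≤ ε) {c : ℝ} (hc : 1 ≤ c)
    {D : Finset (Fin n)} (hD : ∀ e ∈ D, 0 < greedyGroup v A τ K T e)
    (hcard : ∀ i < T, ((D.filter fun e => greedyGroup v A τ K T e = i + 1).card : ℝ) ≤
      c * 2 ^ (i + 1)) :
    f (inducedVec v D) ≤ (4 * c + ε) * f (inducedVec v A) := by
  classical
  have hτ0 : 0 ≤ τ := by
    rcases hτ with h | ⟨e, _, h⟩
    · exact h.ge
    · exact h ▸ hv e
  set g := greedyGroup v A τ K T with hg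
  set h := greedyCut (countAbove v A τ) K with hh
  have hgT : ∀ e, g e ≤ T := greedyGroup_le
  have hlev : ∀ e ∈ D, v e ≤ τ * (3 / 4) ^ h (g e - 1) := by
    intro e he
    have h1 : 0 < g e := hD e he
    have h2 := hgT e
    have h3 : g e - 1 < g e := by omega
    exact (lt_greedyGroup_iff hτ0 (by omega) e).1 h3
  have hw0 : 0 ≤ inducedVec v A := fun e => by
    simp only [inducedVec, Pi.zero_apply]
    split_ifs
    exacts [hv e, le_rfl]
  set L := D.filter fun e => h (g e - 1) < K with hL
  -- the levels above `K`
  have hlarge : f (inducedVec v L) ≤ 4 * c * f (inducedVec v A) := by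
    have h43 : f ((4 / 3 : ℝ) • inducedVec v A) = 4 / 3 * f (inducedVec v A) := by
      rw [hf.smul_eq]; norm_num
    have key : f (inducedVec v L) ≤ 3 * c * f ((4 / 3 : ℝ) • inducedVec v A) := by
      refine hf.le_of_card_le (fun e => ?_) (smul_nonneg (by norm_num) hw0) (by linarith)
        fun θ hθ => ?_
      · simp only [inducedVec, Pi.zero_apply]
        split_ifs
        exacts [hv e, le_rfl]
      set B := Finset.univ.filter fun e => θ ≤ inducedVec v L e with hB
      have hmem : ∀ e ∈ B, e ∈ D ∧ h (g e - 1) < K ∧ θ ≤ v e := by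
        intro e he
        have he' := (Finset.mem_filter.1 he).2
        by_cases heL : e ∈ L
        · rw [inducedVec, if_pos heL] at he'
          exact ⟨(Finset.mem_filter.1 heL).1, (Finset.mem_filter.1 heL).2, he'⟩
        · rw [inducedVec, if_neg heL] at he'
          exact absurd he' (not_le.2 hθ)
      rcases B.eq_empty_or_nonempty with hBe | hBne
      · rw [hBe, Finset.card_empty, Nat.cast_zero]
        positivity
      obtain ⟨e₀, he₀, hmax⟩ := B.exists_max_image g hBne
      obtain ⟨heD, heK, heθ⟩ := hmem e₀ he₀
      have hpos := hD e₀ heD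
      have hi : g e₀ - 1 < T := by have := hgT e₀; change 0 < g e₀ at hpos; omega
      have hsub : B ⊆ D.filter fun e => g e ≤ g e₀ - 1 + 1 := fun e he =>
        Finset.mem_filter.2 ⟨(hmem e he).1, (hmax e he).trans (by omega)⟩
      have h1 : (B.card : ℝ) ≤ _ := (Nat.cast_le.2 (Finset.card_le_card hsub)).trans
        (card_le_usedBudget hτ0 hD hcard hi)
      have hτθ : θ ≤ τ * (3 / 4) ^ h (g e₀ - 1) := heθ.trans (hlev e₀ heD)
      have hτpos : 0 < τ := by
        rcases hτ0.eq_or_lt with h0 | h0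
        · rw [← h0, zero_mul] at hτθ
          linarith
        · exact h0
      have hN1 : 1 ≤ countAbove v A τ 1 := by
        obtain ⟨e, he, hve⟩ := hτ.resolve_left hτpos.ne'
        exact Finset.card_pos.2 ⟨e, Finset.mem_filter.2 ⟨he, by rw [hve]; linarith⟩⟩
      have h2 := (usedBudget_le (K := K) (countAbove_mono hτ0) hN1 (g e₀ - 1)).2 heK
      have h3 : countAbove v A τ (h (g e₀ - 1) + 1) ≤
          (Finset.univ.filter fun e => θ ≤ ((4 / 3 : ℝ) • inducedVec v A) e).card := by
        refine Finset.card_le_card fun e he => ?_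
        obtain ⟨heA, hlt⟩ := Finset.mem_filter.1 he
        refine Finset.mem_filter.2 ⟨Finset.mem_univ _, ?_⟩
        rw [Pi.smul_apply, smul_eq_mul, inducedVec, if_pos heA]
        rw [pow_succ] at hlt
        linarith
      calc (B.card : ℝ) ≤ c * ((2 ^ (g e₀ - 1 + 1) +
            usedBudget (countAbove v A τ) K (g e₀ - 1) : ℕ) : ℝ) := h1
        _ ≤ c * ((3 * (Finset.univ.filter fun e =>
              θ ≤ ((4 / 3 : ℝ) • inducedVec v A) e).card : ℕ) : ℝ) := by
          gcongr
          exact h2.trans (Nat.mul_le_mul_left 3 h3)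
        _ = _ := by push_cast; ring
    rw [h43] at key
    linarith
  -- the lowest level
  have hsmall : f (inducedVec v (D \ L)) ≤ ε * f (inducedVec v A) := by
    have hb : ∀ e ∈ D \ L, v e ≤ τ * (3 / 4) ^ K := by
      intro e he
      obtain ⟨heD, heL⟩ := Finset.mem_sdiff.1 he
      have hle : K ≤ h (g e - 1) := by
        by_contra hlt
        exact heL (Finset.mem_filter.2 ⟨heD, not_le.1 hlt⟩)
      exact (hlev e heD).trans (level_anti hτ0 hle)
    have hsum : f (inducedVec v (D \ L)) ≤ ∑ e : Fin n, f (Pi.single e (τ * (3 / 4) ^ K)) := by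
      refine le_trans (hf.mono (∑ e : Fin n, Pi.single e (τ * (3 / 4) ^ K)) _ (fun e => ?_)
        fun e => ?_) (hf.sum_le _ _)
      · simp only [inducedVec, Pi.zero_apply]
        split_ifs
        exacts [hv e, le_rfl]
      · rw [Finset.univ_sum_single (fun _ : Fin n => τ * (3 / 4 : ℝ) ^ K)]
        simp only [inducedVec]
        split_ifs with he
        exacts [hb e he, by positivity]
    have hsingle : ∀ e : Fin n, f (Pi.single e (τ * (3 / 4) ^ K)) ≤
        (3 / 4) ^ K * f (inducedVec v A) := by
      intro e
      have h1 : (Pi.single e (τ * (3 / 4) ^ K) : Fin n → ℝ) = (3 / 4 : ℝ) ^ K • Pi.single e τ := by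
        rw [← Pi.single_smul, smul_eq_mul, mul_comm]
      rw [h1, hf.smul_eq, abs_of_pos (by positivity)]
      refine mul_le_mul_of_nonneg_left ?_ (by positivity)
      rcases hτ with h0 | ⟨a, haA, ha⟩
      · rw [h0, Pi.single_zero, hf.zero]
        exact hf.nonneg _
      · have h2 : (Pi.single e τ : Fin n → ℝ) = (Pi.single a τ : Fin n → ℝ) ∘ Equiv.swap e a := by
          ext x
          simp only [Function.comp, Pi.single_apply, Equiv.swap_apply_eq_iff,
            Equiv.swap_apply_right]
        rw [h2, hf.symm]
        refine hf.mono _ _ (by rw [Pi.single_nonneg]; exact hτ0) fun x => ?_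
        by_cases hx : x = a
        · rw [hx, Pi.single_eq_same, inducedVec, if_pos haA, ha]
        · rw [Pi.single_eq_of_ne hx]
          exact hw0 x
    calc f (inducedVec v (D \ L)) ≤ ∑ e : Fin n, f (Pi.single e (τ * (3 / 4) ^ K)) := hsum
      _ ≤ ∑ _e : Fin n, (3 / 4) ^ K * f (inducedVec v A) := Finset.sum_le_sum fun e _ => hsingle e
      _ = n * (3 / 4) ^ K * f (inducedVec v A) := by simp [mul_assoc]
      _ ≤ _ := mul_le_mul_of_nonneg_right hK (hf.nonneg _)
  have hsplit : inducedVec v D = inducedVec v L + inducedVec v (D \ L) := by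
    ext e
    simp only [inducedVec, Pi.add_apply, Finset.mem_sdiff]
    by_cases h1 : e ∈ L
    · simp [h1, (Finset.mem_filter.1 h1).1]
    · by_cases h2 : e ∈ D <;> simp [h1, h2]
  rw [hsplit, add_mul]
  exact (hf.add_le _ _).trans (add_le_add hlarge hsmall)

end Grouping

/-! ### Threshold sequences as bit lists -/

/-- A list of bits describes a nonincreasing sequence of thresholds: `false` lowers the current
threshold by the factor `3 / 4`, and `true` adds it to the sequence. The value is the number of
thresholds that are at least `u`. -/
noncomputable def thresholdRank (u : ℝ) : ℝ → List Bool → ℕ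
  | _, [] => 0
  | θ, false :: b => thresholdRank u (3 / 4 * θ) b
  | θ, true :: b => thresholdRank u θ b + if u ≤ θ then 1 else 0

theorem thresholdRank_replicate (u : ℝ) (m : ℕ) (θ : ℝ) (b : List Bool) :
    thresholdRank u θ (List.replicate m false ++ b) = thresholdRank u (θ * (3 / 4) ^ m) b := by
  induction m generalizing θ with
  | zero => simp
  | succ m ih =>
    rw [List.replicate_succ, List.cons_append, thresholdRank, ih]
    congr 1
    ring

/-- Every nondecreasing sequence of levels up to `K` is described by a list of bits. -/
theorem exists_bits (τ : ℝ) (K T lo : ℕ) (h : ℕ → ℕ) (hh : Monotone h) (hlo : lo ≤ h 0)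
    (hK : ∀ i, h i ≤ K) : ∃ b : List Bool, b.length = T + (K - lo) ∧ ∀ u,
      thresholdRank u (τ * (3 / 4) ^ lo) b =
        ((Finset.range T).filter fun i => u ≤ τ * (3 / 4) ^ h i).card := by
  induction T generalizing lo h with
  | zero =>
    refine ⟨List.replicate (K - lo) false, by simp, fun u => ?_⟩
    have := thresholdRank_replicate u (K - lo) (τ * (3 / 4) ^ lo) []
    rw [List.append_nil] at this
    rw [this]
    simp [thresholdRank]
  | succ T ih =>
    obtain ⟨b, hb, hr⟩ := ih (h 0) (fun i => h (i + 1)) (fun i j hij => hh (by omega))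
      (hh (Nat.zero_le _)) fun i => hK _
    refine ⟨List.replicate (h 0 - lo) false ++ true :: b, ?_, fun u => ?_⟩
    · have := hK 0
      simp only [List.length_append, List.length_replicate, List.length_cons, hb]
      omega
    · rw [thresholdRank_replicate, mul_assoc, ← pow_add, Nat.add_sub_cancel' hlo, thresholdRank,
        hr, Finset.card_filter, Finset.card_filter, Finset.sum_range_succ']

namespace PolyComp

variable {ι α : Type} [TreeCode α] {M : Setting ι} {e : ι → α}

theorem thresholdRank {u τ : ι → ℝ} {b : ι → List Bool}
    (hlen : PolyBdd M.size fun i => (b i).length) (hu : PolyComp M e u) (hτ : PolyComp M e τ)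
    (hb : PolyComp M e b) :
    PolyComp M e fun i => (thresholdRank (u i) (τ i) (b i) : ℝ) := by
  have hbit : PolyComp (M.comap (fun j : ι × (ℝ × ℝ) × Bool => j.1)) (fun j => (e j.1, j.2))
      fun j => if j.2.2 then (1 : ℝ) else 0 := refl.snd.snd.congr_enc fun _ => rfl
  refine (foldl (b := fun i => (τ i, (0 : ℝ)))
    (g := fun i s b => if (0 : ℝ) < (if b then 1 else 0) then
      (s.1, s.2 + if u i ≤ s.1 then 1 else 0) else (3 / 4 * s.1, s.2)) hlen hb (hτ.pair (const 0))
    (ite (const 0) hbit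
      (refl.snd.fst.fst.pair (refl.snd.fst.snd.add
        (ite_le hu.lift refl.snd.fst.fst (const 1) (const 0))))
      (((const (3 / 4)).mul refl.snd.fst.fst).pair refl.snd.fst.snd))).snd.of_eq fun i => ?_
  have h : ∀ (b : List Bool) (θ s : ℝ), (b.foldl (fun (s : ℝ × ℝ) (b : Bool) =>
      if (0 : ℝ) < (if b then 1 else 0) then (s.1, s.2 + if u i ≤ s.1 then 1 else 0)
      else (3 / 4 * s.1, s.2)) (θ, s)).2 = s + _root_.thresholdRank (u i) θ b := by
    intro b
    induction b with
    | nil => intro θ s; simp [_root_.thresholdRank]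
    | cons a b ih =>
      intro θ s
      cases a
      · simp [_root_.thresholdRank, ih]
      · simp only [List.foldl_cons, if_true, zero_lt_one, ih, _root_.thresholdRank]
        push_cast
        ring
  rw [h, zero_add]

/-- Whether there is an answer. -/
theorem isSome {β : Type} [TreeCode β] {o : ι → Option β} (ho : PolyComp M e o) :
    PolyComp M e fun i => if (o i).isSome then (1 : ℝ) else 0 := by
  refine ho.trans (of_step .isPair fun i => ?_)
  cases o i with
  | none => exact .isPair (.num 0)
  | some a => exact .isPair (.pair (.num 1) (enc a))

theorem getD_nil {β : Type} [TreeCode β] {o : ι → Option (List β)} (ho : PolyComp M e o) :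
    PolyComp M e fun i => (o i).getD [] := by
  refine ho.trans (of_step .snd fun i => ?_)
  cases o i with
  | none => exact .snd (.num 0)
  | some a => exact .snd (.pair (.num 1) (enc a))

theorem some {β : Type} [TreeCode β] {f : ι → β} (hf : PolyComp M e f) :
    PolyComp M e fun i => some (f i) :=
  ((const (1 : ℝ)).pair hf).congr_enc fun _ => rfl

end PolyComp

/-! ### Sets, groups and answers as lists -/

/-- The 0/1 vector of a set. -/
noncomputable def indicatorList {n : ℕ} (D : Finset (Fin n)) : List ℝ :=
  List.ofFn fun e => if e ∈ D then 1 else 0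

theorem enc_ofFn {n : ℕ} (w : Fin n → ℝ) : enc (List.ofFn w) = RTree.ofVec w := enc_list_real _

theorem enc_indicatorList {n : ℕ} (D : Finset (Fin n)) :
    enc (indicatorList D) = RTree.ofSet D := enc_ofFn _

theorem enc_answer {n : ℕ} (A : Option (Finset (Fin n))) :
    enc (A.map indicatorList) = RTree.ofAnswer A := by
  cases A with
  | none => rfl
  | some D => exact congrArg (RTree.pair (.num 1)) (enc_indicatorList D)

theorem zipWith_indicatorList {n : ℕ} (v : Fin n → ℝ) (D : Finset (Fin n)) :
    List.zipWith (fun a b => a * b) (List.ofFn v) (indicatorList D) =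
      List.ofFn (inducedVec v D) := by
  refine List.ext_getElem (by simp [indicatorList]) fun i h1 h2 => ?_
  simp [indicatorList, inducedVec]

/-- The groups of an assignment of group numbers. -/
def groupsOf {n : ℕ} (g : Fin n → ℕ) (i : Fin (numGroups n)) : Finset (Fin n) :=
  Finset.univ.filter fun e => g e = i + 1

theorem disjoint_groupsOf {n : ℕ} (g : Fin n → ℕ) (i j : Fin (numGroups n)) (hij : i ≠ j) :
    Disjoint (groupsOf g i) (groupsOf g j) := by
  refine Finset.disjoint_left.2 fun e hi hj => hij (Fin.ext ?_)
  simp only [groupsOf, Finset.mem_filter, Finset.mem_univ, true_and] at hi hj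
  omega

theorem groupIndex_groupsOf {n : ℕ} (g : Fin n → ℕ) (hg : ∀ e, g e ≤ numGroups n) (e : Fin n) :
    groupIndex (groupsOf g) e = g e := by
  simp only [groupIndex, groupsOf, Finset.mem_filter, Finset.mem_univ, true_and]
  rcases Nat.eq_zero_or_pos (g e) with h | h
  · rw [h, Nat.cast_zero]
    exact Finset.sum_eq_zero fun i _ => if_neg (by omega)
  · have hlt : g e - 1 < numGroups n := by have := hg e; omega
    rw [Finset.sum_eq_single (⟨g e - 1, hlt⟩ : Fin (numGroups n))]
    · rw [if_pos (by dsimp only; omega)]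
      dsimp only
      rw [Nat.cast_sub h, Nat.cast_one, sub_add_cancel]
    · intro i _ hi
      refine if_neg fun h' => hi (Fin.ext ?_)
      dsimp only
      omega
    · exact fun h' => absurd (Finset.mem_univ _) h'

theorem isValidSolution_groupsOf {n : ℕ} {F : Set (Finset (Fin n))} {g : Fin n → ℕ}
    (hg : ∀ e, g e ≤ numGroups n) {c' : ℝ} {D : Finset (Fin n)} :
    IsValidSolution F (groupsOf g) c' D ↔ D ∈ F ∧ (∀ e ∈ D, 0 < g e) ∧
      ∀ i < numGroups n, ((D.filter fun e => g e = i + 1).card : ℝ) ≤ c' * 2 ^ (i + 1) := by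
  refine and_congr_right fun _ => and_congr ⟨fun h e he => ?_, fun h e he => ?_⟩
    ⟨fun h i hi => ?_, fun h i => ?_⟩
  · obtain ⟨i, -, hi⟩ := Finset.mem_biUnion.1 (h he)
    have := (Finset.mem_filter.1 hi).2
    omega
  · have h1 := h e he
    have h2 := hg e
    refine Finset.mem_biUnion.2 ⟨⟨g e - 1, by omega⟩, Finset.mem_univ _,
      Finset.mem_filter.2 ⟨Finset.mem_univ _, ?_⟩⟩
    dsimp only
    omega
  · convert h ⟨i, hi⟩ using 3
    ext e
    simp [groupsOf]
  · convert h i i.2 using 3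
    ext e
    simp [groupsOf]

/-! ### From budgets to norms -/

/-- One step of the search for the best candidate. A candidate consists of a flag (positive if there
is a solution), its norm and its 0/1 vector. -/
noncomputable def better (s a : ℝ × ℝ × List ℝ) : ℝ × ℝ × List ℝ :=
  if 0 < a.1 then if 0 < s.1 then if a.2.1 < s.2.1 then a else s else a else s

theorem foldl_better (l : List (ℝ × ℝ × List ℝ)) (s : ℝ × ℝ × List ℝ) :
    (l.foldl better s = s ∨ l.foldl better s ∈ l) ∧
      ∀ a, a = s ∨ a ∈ l → 0 < a.1 →
        0 < (l.foldl better s).1 ∧ (l.foldl better s).2.1 ≤ a.2.1 := by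
  induction l generalizing s with
  | nil =>
    refine ⟨Or.inl rfl, fun a ha h => ?_⟩
    rcases ha with rfl | ha
    · exact ⟨h, le_rfl⟩
    · simp at ha
  | cons b l ih =>
    obtain ⟨h1, h2⟩ := ih (better s b)
    have hb : better s b = s ∨ better s b = b := by
      simp only [better]
      split_ifs <;> simp
    rw [List.foldl_cons]
    refine ⟨?_, fun a ha hpos => ?_⟩
    · rcases h1 with h1 | h1
      · rw [h1]
        rcases hb with hb | hb <;> simp [hb]
      · exact Or.inr (List.mem_cons_of_mem _ h1)
    · have hle : a = s ∨ a = b → 0 < (better s b).1 ∧ (better s b).2.1 ≤ a.2.1 := by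
        rintro (rfl | rfl)
        · simp only [better]
          split_ifs with h3 h4 <;> first | exact ⟨h3, h4.le⟩ | exact ⟨hpos, le_rfl⟩
        · simp only [better, if_pos hpos]
          split_ifs with h3 h4
          · exact ⟨hpos, le_rfl⟩
          · exact ⟨h3, not_lt.1 h4⟩
          · exact ⟨hpos, le_rfl⟩
      have hfin : a = s ∨ a = b → 0 < (l.foldl better (better s b)).1 ∧
          (l.foldl better (better s b)).2.1 ≤ a.2.1 := fun h =>
        ⟨(h2 _ (Or.inl rfl) (hle h).1).1, (h2 _ (Or.inl rfl) (hle h).1).2.trans (hle h).2⟩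
      rcases ha with rfl | ha
      · exact hfin (Or.inl rfl)
      · rcases List.mem_cons.1 ha with rfl | ha
        · exact hfin (Or.inr rfl)
        · exact h2 a (Or.inr ha) hpos

theorem PolyComp.better {ι α : Type} [TreeCode α] {M : Setting ι} {e : ι → α}
    {s a : ι → ℝ × ℝ × List ℝ} (hs : PolyComp M e s) (ha : PolyComp M e a) :
    PolyComp M e fun i => better (s i) (a i) :=
  ite (const 0) ha.fst (ite (const 0) hs.fst (ite ha.snd.fst hs.snd.fst ha hs) ha) hs

/-- The group numbers that belong to a largest value and a list of bits. -/
noncomputable def candidateGroup {n : ℕ} (v : Fin n → ℝ) (q : ℝ × List Bool) (e : Fin n) : ℕ :=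
  min (thresholdRank (v e) q.1 q.2) (numGroups n)

theorem candidateGroup_le {n : ℕ} (v : Fin n → ℝ) (q : ℝ × List Bool) (e : Fin n) :
    candidateGroup v q e ≤ numGroups n := min_le_right _ _

/-- The number of levels. After them the values are smaller by a factor `ε / n`. -/
def numLevels (C n : ℕ) : ℕ := 3 * numGroups n + C

theorem mul_pow_numLevels_le {ε : ℝ} {C : ℕ} (hC : (3 / 4 : ℝ) ^ C ≤ ε) (n : ℕ) :
    n * (3 / 4 : ℝ) ^ numLevels C n ≤ ε := by
  have h1 : (n : ℝ) ≤ 2 ^ numGroups n := by exact_mod_cast Nat.le_pow_clog one_lt_two n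
  have h2 : (n : ℝ) * ((3 / 4 : ℝ) ^ 3) ^ numGroups n ≤ 1 :=
    calc (n : ℝ) * ((3 / 4 : ℝ) ^ 3) ^ numGroups n
        ≤ 2 ^ numGroups n * ((3 / 4 : ℝ) ^ 3) ^ numGroups n := by gcongr
      _ = (2 * (3 / 4 : ℝ) ^ 3) ^ numGroups n := by rw [mul_pow]
      _ ≤ 1 := pow_le_one₀ (by norm_num) (by norm_num)
  rw [numLevels, pow_add, pow_mul, ← mul_assoc]
  calc _ ≤ 1 * (3 / 4 : ℝ) ^ C := by gcongr
    _ ≤ ε := by rwa [one_mul]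

/-- The candidates: the largest value in the optimal set is `0` or one of the given values. -/
noncomputable def candidates {n : ℕ} (C : ℕ) (v : Fin n → ℝ) : List (ℝ × List Bool) :=
  (0 :: List.ofFn v) ×ˢ bitLists (numGroups n + numLevels C n)

/-- Some candidate is right for a given set `A`. -/
theorem exists_candidate {n : ℕ} {F : Set (Finset (Fin n))} {v : Fin n → ℝ} (hv : ∀ e, 0 ≤ v e)
    (hn : 1 < n) {ε : ℝ} {C : ℕ} (hC : (3 / 4 : ℝ) ^ C ≤ ε) {A : Finset (Fin n)} (hA : A ∈ F) :
    ∃ q ∈ candidates C v, IsValidSolution F (groupsOf (candidateGroup v q)) 1 A ∧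
      ∀ f : (Fin n → ℝ) → ℝ, IsSymmMonotoneNorm f → ∀ c : ℝ, 1 ≤ c → ∀ D,
        IsValidSolution F (groupsOf (candidateGroup v q)) c D →
        f (inducedVec v D) ≤ (4 * c + ε) * f (inducedVec v A) := by
  obtain ⟨τ, hτmem, hτ, hAτ⟩ : ∃ τ : ℝ, τ ∈ 0 :: List.ofFn v ∧ (τ = 0 ∨ ∃ e ∈ A, v e = τ) ∧
      ∀ e ∈ A, v e ≤ τ := by
    rcases A.eq_empty_or_nonempty with rfl | h
    · exact ⟨0, List.mem_cons_self, Or.inl rfl, by simp⟩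
    · obtain ⟨e, he, hmax⟩ := A.exists_max_image v h
      exact ⟨v e, List.mem_cons_of_mem _ ((List.mem_ofFn' _ _).2 ⟨e, rfl⟩),
        Or.inr ⟨e, he, rfl⟩, hmax⟩
  have hτ0 : 0 ≤ τ := by
    rcases hτ with h | ⟨e, _, h⟩
    · exact h.ge
    · exact h ▸ hv e
  have hT : 0 < numGroups n := Nat.clog_pos one_lt_two hn
  obtain ⟨b, hb, hr⟩ := exists_bits τ (numLevels C n) (numGroups n) 0
    (greedyCut (countAbove v A τ) (numLevels C n)) greedyCut_mono (Nat.zero_le _) greedyCut_le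
  have hg : ∀ e, candidateGroup v (τ, b) e =
      greedyGroup v A τ (numLevels C n) (numGroups n) e := by
    intro e
    have h := hr (v e)
    rw [pow_zero, mul_one] at h
    simp only [candidateGroup, h]
    exact min_eq_left (greedyGroup_le e)
  refine ⟨(τ, b), List.mem_product.2 ⟨hτmem, mem_bitLists hb⟩, ?_, fun f hf c hc D hD => ?_⟩
  · rw [isValidSolution_groupsOf (candidateGroup_le v _)]
    refine ⟨hA, fun e he => ?_, fun i hi => ?_⟩
    · rw [hg]
      exact greedyGroup_pos hτ0 hT (hAτ e he)
    · simp only [hg]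
      rw [one_mul]
      exact_mod_cast card_greedyGroup_le hτ0 (Nat.le_pow_clog one_lt_two n) hi
  · rw [isValidSolution_groupsOf (candidateGroup_le v _)] at hD
    simp only [hg] at hD
    exact norm_le_of_greedyGroup hf hv hτ (mul_pow_numLevels_le hC n) hc hD.2.1 hD.2.2

/-- The inputs of the norm minimization version. -/
structure MinNormInput (Q : SubsetProblem) where
  /-- the instance -/
  x : RTree
  mem : x ∈ Q.instances
  /-- the values -/
  v : Fin (Q.card x) → ℝ
  v_nonneg : ∀ e, 0 ≤ v e
  /-- the norm -/
  f : (Fin (Q.card x) → ℝ) → ℝ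
  isNorm : IsSymmMonotoneNorm f

namespace MinNormInput

variable {Q : SubsetProblem}

/-- Machines with the value oracle of the norm. -/
def setting (Q : SubsetProblem) : Setting (MinNormInput Q) :=
  ⟨fun i => valueOracle i.f, fun i => (RTree.pair i.x (RTree.ofVec i.v)).size⟩

/-- The part of the input that is given explicitly. -/
noncomputable def data (i : MinNormInput Q) : RTree × List ℝ := (i.x, List.ofFn i.v)

theorem enc_data (i : MinNormInput Q) : enc i.data = .pair i.x (.ofVec i.v) :=
  congrArg (RTree.pair i.x) (enc_ofFn i.v)

theorem polyBdd_card : PolyBdd (setting Q).size fun i => Q.card i.x := by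
  refine PolyBdd.self.mono fun i => ?_
  simp only [setting, RTree.size, RTree.size_ofVec]
  omega

theorem polyBdd_length : PolyBdd (setting Q).size fun i => (List.ofFn i.v).length := by
  simpa using polyBdd_card

/-- An instance together with some vector has the size of the input. -/
theorem polyBdd_size {κ : Type} (g : κ → MinNormInput Q) (w : ∀ j, Fin (Q.card (g j).x) → ℝ) :
    PolyBdd ((setting Q).comap g).size fun j => (enc ((g j).x, List.ofFn (w j))).size := by
  refine PolyBdd.self.mono fun j => le_of_eq ?_
  have h : enc ((g j).x, List.ofFn (w j)) = .pair (g j).x (.ofVec (w j)) :=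
    congrArg (RTree.pair _) (enc_ofFn _)
  rw [h]
  simp only [setting, Setting.comap, RTree.size, RTree.size_ofVec]

/-- The best of the candidates, where `sol` solves the budgeted version for given groups. -/
noncomputable def best (C : ℕ)
    (sol : ∀ i : MinNormInput Q, (Fin (Q.card i.x) → ℕ) → Option (Finset (Fin (Q.card i.x))))
    (i : MinNormInput Q) : ℝ × ℝ × List ℝ :=
  ((candidates C i.v).map fun q =>
    ((if (sol i (candidateGroup i.v q)).isSome then (1 : ℝ) else 0),
      i.f (inducedVec i.v ((sol i (candidateGroup i.v q)).getD ∅)),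
      indicatorList ((sol i (candidateGroup i.v q)).getD ∅))).foldl better (0, 0, [])

theorem polyComp_best {p₀ : RProg} {P₀ : Polynomial ℕ}
    {sol : ∀ i : MinNormInput Q, (Fin (Q.card i.x) → ℕ) → Option (Finset (Fin (Q.card i.x)))}
    (hrun : ∀ (i : MinNormInput Q) (g : Fin (Q.card i.x) → ℕ),
      (∀ e, g e ≤ numGroups (Q.card i.x)) → p₀.RunsWithin noOracle P₀
        (.pair i.x (.ofVec (groupIndex (groupsOf g)))) (.ofAnswer (sol i g))) (C : ℕ) :
    PolyComp (setting Q) data (best C sol) := by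
  have hv : PolyComp (setting Q) data fun i => List.ofFn i.v := PolyComp.refl.snd
  have htl := (hv.clogList polyBdd_length).of_eq
    (f' := fun i => List.replicate (numGroups (Q.card i.x)) (0 : ℝ)) fun i => by
      rw [List.length_ofFn]; rfl
  have htlen : PolyBdd (setting Q).size fun i =>
      (List.replicate (numGroups (Q.card i.x)) (0 : ℝ)).length := by
    simpa using polyBdd_card.mono (s := fun i => numGroups (Q.card i.x)) fun i => Nat.clog_two_le _
  have hpow : PolyBdd (setting Q).size fun i =>
      2 ^ (numGroups (Q.card i.x) + numLevels C (Q.card i.x)) := by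
    refine (((((PolyBdd.const 2).mul polyBdd_card).add (.const 1)).pow 4).mul
      (.const (2 ^ C))).mono fun i => ?_
    have h : numGroups (Q.card i.x) + numLevels C (Q.card i.x) =
        numGroups (Q.card i.x) * 4 + C := by
      rw [numLevels]; ring
    rw [h, pow_add, pow_mul]
    gcongr
    exact Nat.two_pow_clog_le _
  have hbitlen : PolyBdd (setting Q).size fun i =>
      numGroups (Q.card i.x) + numLevels C (Q.card i.x) :=
    hpow.mono fun i => Nat.lt_two_pow_self.le
  have hbits : PolyComp (setting Q) data fun i =>
      bitLists (numGroups (Q.card i.x) + numLevels C (Q.card i.x)) := by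
    have hl := htl.append htlen (htl.append htlen (htl.append htlen (htl.append htlen
      (PolyComp.const (List.replicate C (0 : ℝ))))))
    refine (PolyComp.bitLists ?_ hl).of_eq fun i => ?_
    · refine hpow.mono fun i => le_of_eq ?_
      simp only [List.length_append, List.length_replicate, numLevels]
      congr 1
      ring
    · simp only [List.length_append, List.length_replicate, numLevels]
      congr 1
      ring
  have hcand : PolyComp (setting Q) data fun i => candidates C i.v := by
    refine PolyComp.product ?_ ?_ ((PolyComp.const 0).cons hv) hbits
    · simpa using polyBdd_card.add (.const 1)
    · simpa only [length_bitLists] using hpow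
  have hcandlen : PolyBdd (setting Q).size fun i => (candidates C i.v).length := by
    simp only [candidates, List.length_product, length_bitLists, List.length_cons, List.length_ofFn]
    exact (polyBdd_card.add (.const 1)).mul hpow
  -- the work for one candidate
  let κ := {j : MinNormInput Q × ℝ × List Bool //
    j.2.2.length ≤ numGroups (Q.card j.1.x) + numLevels C (Q.card j.1.x)}
  let M : Setting κ := (setting Q).comap fun j => j.1.1
  let E : κ → (RTree × List ℝ) × ℝ × List Bool := fun j => (j.1.1.data, j.1.2)
  let D : ∀ j : κ, Finset (Fin (Q.card j.1.1.x)) := fun j =>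
    (sol j.1.1 (candidateGroup j.1.1.v j.1.2)).getD ∅
  have hvE : PolyComp M E fun j => List.ofFn j.1.1.v := hv.lift
  have hvElen : PolyBdd M.size fun j => (List.ofFn j.1.1.v).length := polyBdd_length.comap _
  have hlenE : PolyComp M E fun j =>
      ((List.replicate (numGroups (Q.card j.1.1.x)) (0 : ℝ)).length : ℝ) :=
    (htl.length htlen).lift
  have hgroups : PolyComp M E fun j =>
      List.ofFn (groupIndex (groupsOf (candidateGroup j.1.1.v j.1.2))) := by
    refine (hvE.map (g := fun j u => min (thresholdRank u j.1.2.1 j.1.2.2 : ℝ)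
      ((List.replicate (numGroups (Q.card j.1.1.x)) (0 : ℝ)).length : ℝ)) hvElen
      ((PolyComp.thresholdRank ?_ PolyComp.refl.snd PolyComp.refl.fst.snd.fst
        PolyComp.refl.fst.snd.snd).min (hlenE.lift))).of_eq fun j => ?_
    · exact (hbitlen.comap fun j : κ × ℝ => j.1.1.1).mono fun j => j.1.2
    · rw [List.map_ofFn]
      congr 1
      funext e
      rw [groupIndex_groupsOf _ (candidateGroup_le _ _)]
      simp [candidateGroup]
  have hsol : PolyComp M E fun j =>
      (sol j.1.1 (candidateGroup j.1.1.v j.1.2)).map indicatorList := by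
    refine (PolyComp.refl.fst.fst.pair hgroups).trans (PolyComp.of_runsWithin p₀ P₀
      (O := fun _ => noOracle) (fun _ _ _ h => h.elim) (polyBdd_size _ _) fun j => ?_)
    rw [enc_answer]
    have h : enc (j.1.1.x, List.ofFn (groupIndex (groupsOf (candidateGroup j.1.1.v j.1.2)))) =
        .pair j.1.1.x (.ofVec (groupIndex (groupsOf (candidateGroup j.1.1.v j.1.2)))) :=
      congrArg (RTree.pair _) (enc_ofFn _)
    exact h ▸ hrun j.1.1 _ (candidateGroup_le _ _)
  have hflag : PolyComp M E fun j =>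
      if (sol j.1.1 (candidateGroup j.1.1.v j.1.2)).isSome then (1 : ℝ) else 0 :=
    hsol.isSome.of_eq fun j => by rw [Option.isSome_map]
  have hind : PolyComp M E fun j => indicatorList (D j) := by
    refine (PolyComp.ite (.const 0) hflag hsol.getD_nil
      (hvE.map (g := fun _ _ => (0 : ℝ)) hvElen (.const 0))).of_eq fun j => ?_
    simp only [D]
    cases sol j.1.1 (candidateGroup j.1.1.v j.1.2) with
    | none => simp [indicatorList, List.map_ofFn, Function.comp_def]
    | some D => simp
  have hval : PolyComp M E fun j => j.1.1.f (inducedVec j.1.1.v (D j)) := by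
    have hw : PolyComp M E fun j => List.ofFn (inducedVec j.1.1.v (D j)) :=
      (PolyComp.zipWith (g := fun _ a b => a * b) hvElen (fun j => by simp [indicatorList]) hvE hind
        (PolyComp.refl.snd.fst.mul PolyComp.refl.snd.snd)).of_eq fun j => zipWith_indicatorList _ _
    exact hw.query fun j => ⟨_, enc_ofFn _, rfl⟩
  have hresults := hcand.map_of (g := fun i q =>
      ((if (sol i (candidateGroup i.v q)).isSome then (1 : ℝ) else 0),
        i.f (inducedVec i.v ((sol i (candidateGroup i.v q)).getD ∅)),
        indicatorList ((sol i (candidateGroup i.v q)).getD ∅)))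
    (fun i q => q.2.length ≤ numGroups (Q.card i.x) + numLevels C (Q.card i.x)) hcandlen
    (fun i q hq => ?_) (hflag.pair (hval.pair hind))
  · exact hresults.foldl (g := fun _ => better) (by simpa using hcandlen) (.const _)
      (PolyComp.better PolyComp.refl.snd.fst PolyComp.refl.snd.snd)
  · have := (List.mem_product.1 (show (q.1, q.2) ∈ _ from hq)).2
    exact (length_of_mem_bitLists this).le

end MinNormInput

namespace MinNormInput

variable {Q : SubsetProblem}

/-- For a universe of at most one element only the empty and the full set have to be tested. -/
theorem polyComp_small (hQ : Q.PolyTimeMembership) : ∃ out : MinNormInput Q → Option (List ℝ),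
    PolyComp (setting Q) data out ∧ ∀ i, Q.card i.x ≤ 1 → ∃ A : Option (Finset (Fin (Q.card i.x))),
      enc (out i) = .ofAnswer A ∧
      match A with
      | some S => S ∈ Q.feasible i.x ∧ ∀ S' ∈ Q.feasible i.x, f i (inducedVec i.v S) ≤
          f i (inducedVec i.v S')
      | none => Q.feasible i.x = ∅ := by
  classical
  obtain ⟨p, P, hp⟩ := hQ
  have hmem : ∀ D : ∀ i : MinNormInput Q, Finset (Fin (Q.card i.x)),
      PolyComp (setting Q) data (fun i => indicatorList (D i)) →
      PolyComp (setting Q) data fun i => if D i ∈ Q.feasible i.x then (1 : ℝ) else 0 := by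
    intro D hD
    refine (PolyComp.refl.fst.pair hD).trans (PolyComp.of_runsWithin p P (O := fun _ => noOracle)
      (fun _ _ _ h => h.elim) (polyBdd_size (fun i => i) _) fun i => ?_)
    obtain ⟨y, hy, h⟩ := hp i.x i.mem (D i)
    have he : enc (i.x, indicatorList (D i)) = .pair i.x (.ofSet (D i)) :=
      congrArg (RTree.pair _) (enc_indicatorList _)
    change p.RunsWithin noOracle P (enc (i.x, indicatorList (D i))) _
    rw [he]
    rcases h with ⟨h, rfl⟩ | ⟨h, rfl⟩
    · rw [if_pos h]; exact hy
    · rw [if_neg h]; exact hy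
  have hv : PolyComp (setting Q) data fun i => List.ofFn i.v := PolyComp.refl.snd
  have hconst : ∀ r : ℝ, PolyComp (setting Q) data fun i =>
      List.ofFn fun _ : Fin (Q.card i.x) => r := fun r =>
    (hv.map (g := fun _ _ => r) polyBdd_length (.const r)).of_eq fun i => by
      simp [List.map_ofFn, Function.comp_def]
  have hempty : PolyComp (setting Q) data fun i =>
      indicatorList (∅ : Finset (Fin (Q.card i.x))) := by
    simpa [indicatorList] using hconst 0
  have hfull : PolyComp (setting Q) data fun i =>
      indicatorList (Finset.univ : Finset (Fin (Q.card i.x))) := by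
    simpa [indicatorList] using hconst 1
  refine ⟨_, PolyComp.ite (.const 0) (hmem _ hempty) hempty.some
    (PolyComp.ite (.const 0) (hmem _ hfull) hfull.some (.const none)), fun i hi => ?_⟩
  have hsub : ∀ S : Finset (Fin (Q.card i.x)), S = ∅ ∨ S = Finset.univ := by
    intro S
    have : Subsingleton (Fin (Q.card i.x)) := Fin.subsingleton_iff_le_one.2 hi
    rcases S.eq_empty_or_nonempty with h | ⟨a, ha⟩
    · exact Or.inl h
    · exact Or.inr (Finset.eq_univ_iff_forall.2 fun b => Subsingleton.elim a b ▸ ha)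
  by_cases h0 : ∅ ∈ Q.feasible i.x
  · refine ⟨some ∅, ?_, h0, fun S' _ => ?_⟩
    · rw [if_pos (by rw [if_pos h0]; exact one_pos)]
      exact enc_answer (some ∅)
    · refine i.isNorm.mono _ _ (fun e => ?_) fun e => ?_
      · simp [inducedVec]
      · simp only [inducedVec, Finset.notMem_empty, if_false]
        split_ifs
        exacts [i.v_nonneg e, le_rfl]
  rw [if_neg (by rw [if_neg h0]; exact lt_irrefl _)]
  by_cases h1 : Finset.univ ∈ Q.feasible i.x
  · refine ⟨some Finset.univ, ?_, h1, fun S' hS' => ?_⟩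
    · rw [if_pos (by rw [if_pos h1]; exact one_pos)]
      exact enc_answer (some Finset.univ)
    · rcases hsub S' with rfl | rfl
      · exact absurd hS' h0
      · exact le_rfl
  · refine ⟨none, ?_, Set.eq_empty_iff_forall_notMem.2 fun S hS => ?_⟩
    · rw [if_neg (by rw [if_neg h1]; exact lt_irrefl _)]
      rfl
    · rcases hsub S with rfl | rfl
      exacts [h0 hS, h1 hS]

theorem minNorm_of_polyComp {c : ℕ → ℝ} {out : MinNormInput Q → Option (List ℝ)}
    (hout : PolyComp (setting Q) data out)
    (h : ∀ i, ∃ A : Option (Finset (Fin (Q.card i.x))), enc (out i) = .ofAnswer A ∧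
      match A with
      | some S => S ∈ Q.feasible i.x ∧ ∀ S' ∈ Q.feasible i.x, f i (inducedVec i.v S) ≤
          c (Q.card i.x) * f i (inducedVec i.v S')
      | none => Q.feasible i.x = ∅) : Q.MinNormPolyTimeApprox c := by
  obtain ⟨p, t, ⟨P, hP⟩, hp⟩ := hout
  refine ⟨p, P, fun x hx v hv f hf => ?_⟩
  obtain ⟨k, hk, hrun⟩ := hp ⟨x, hx, v, hv, f, hf⟩
  obtain ⟨A, hA, hspec⟩ := h ⟨x, hx, v, hv, f, hf⟩
  rw [enc_data, hA] at hrun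
  refine ⟨A, ⟨k, hk.trans (hP _), hrun⟩, ?_⟩
  cases A <;> exact hspec

end MinNormInput

theorem SubsetProblem.minNorm_of_logBgt (Q : SubsetProblem) (hQ : Q.PolyTimeMembership)
    (c : ℕ → ℝ) (hc : ∀ n, 1 ≤ c n) (h : Q.LogBgtPolyTime c fun _ => 1) (ε : ℝ) (hε : 0 < ε) :
    Q.MinNormPolyTimeApprox fun n => 4 * c n + ε := by
  obtain ⟨p₀, P₀, h₀⟩ := h
  choose sol hsol using fun (i : MinNormInput Q) (g : Fin (Q.card i.x) → ℕ) =>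
    h₀ i.x i.mem (groupsOf g) (disjoint_groupsOf g)
  obtain ⟨C, hC⟩ := exists_pow_lt_of_lt_one hε (by norm_num : (3 / 4 : ℝ) < 1)
  have hbig := MinNormInput.polyComp_best (sol := sol) (fun i g _ => (hsol i g).1) C
  obtain ⟨small, hsmall, hsmallspec⟩ := MinNormInput.polyComp_small hQ
  have hout := PolyComp.ite (.const 1) (PolyComp.refl.snd.length MinNormInput.polyBdd_length)
    (PolyComp.ite (.const 0) hbig.fst hbig.snd.snd.some (.const none)) hsmall
  refine MinNormInput.minNorm_of_polyComp hout fun i => ?_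
  by_cases hn : 1 < Q.card i.x
  · rw [if_pos (by rw [List.length_ofFn]; exact_mod_cast hn)]
    set r := MinNormInput.best C sol i with hrdef
    obtain ⟨hr, hmin⟩ := foldl_better ((candidates C i.v).map fun q =>
      ((if (sol i (candidateGroup i.v q)).isSome then (1 : ℝ) else 0),
        i.f (inducedVec i.v ((sol i (candidateGroup i.v q)).getD ∅)),
        indicatorList ((sol i (candidateGroup i.v q)).getD ∅))) (0, 0, [])
    rw [← MinNormInput.best, ← hrdef] at hr hmin
    -- what the right candidate for `S'` guarantees
    have hright : ∀ S' ∈ Q.feasible i.x, 0 < r.1 ∧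
        r.2.1 ≤ (4 * c (Q.card i.x) + ε) * i.f (inducedVec i.v S') := by
      intro S' hS'
      obtain ⟨q, hq, hvalid, happrox⟩ := exists_candidate i.v_nonneg hn hC.le hS'
      have hspec := (hsol i (candidateGroup i.v q)).2
      have hm := hmin _ (Or.inr (List.mem_map_of_mem hq))
      cases hs : sol i (candidateGroup i.v q) with
      | none =>
        rw [hs] at hspec
        exact absurd hvalid (hspec S')
      | some D =>
        rw [hs] at hspec hm
        simp only [Option.isSome_some, if_true, zero_lt_one, true_implies] at hm
        exact ⟨hm.1, hm.2.trans (happrox i.f i.isNorm _ (hc _) D hspec)⟩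
    by_cases hpos : 0 < r.1
    · rw [if_pos hpos]
      have hr' := hr.resolve_left fun h0 => by rw [h0] at hpos; exact lt_irrefl _ hpos
      obtain ⟨q, hq, hqr⟩ := List.mem_map.1 hr'
      have hspec := (hsol i (candidateGroup i.v q)).2
      cases hs : sol i (candidateGroup i.v q) with
      | none =>
        rw [hs] at hqr
        rw [← hqr] at hpos
        simp at hpos
      | some D =>
        rw [hs] at hqr hspec
        refine ⟨some D, ?_, hspec.1, fun S' hS' => ?_⟩
        · rw [← hqr]
          exact enc_answer (some D)
        · have := (hright S' hS').2
          rw [← hqr] at this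
          exact this
    · rw [if_neg hpos]
      exact ⟨none, rfl, Set.eq_empty_iff_forall_notMem.2 fun S' hS' => hpos (hright S' hS').1⟩
  · rw [if_neg (by rw [List.length_ofFn]; exact_mod_cast hn)]
    obtain ⟨A, hA, hspec⟩ := hsmallspec i (not_lt.1 hn)
    refine ⟨A, hA, ?_⟩
    cases A with
    | none => exact hspec
    | some S =>
      refine ⟨hspec.1, fun S' hS' => (hspec.2 S' hS').trans
        (le_mul_of_one_le_left (i.isNorm.nonneg _) ?_)⟩
      have := hc (Q.card i.x)
      linarith

/-! ### A norm of weak `ℓ₂` type that can be evaluated in polynomial time -/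

/-- `l * θ + ∑ (|a| - θ)⁺`. Its minimum over `θ ≥ 0` is the sum of the `l` largest absolute
values. -/
noncomputable def excess (l θ : ℝ) (w : List ℝ) : ℝ :=
  w.foldl (fun s a => s + max (|a| - θ) 0) (l * θ)

/-- The sum of the `l` largest absolute values, as the minimum of `excess` over its breakpoints. -/
noncomputable def topSum (l : ℝ) (w : List ℝ) : ℝ :=
  w.foldl (fun s a => min s (excess l |a| w)) (excess l 0 w)

/-- The maximum of `topSum (2 ^ j) / √2 ^ j` over `j < n`. -/
noncomputable def weakNorm {n : ℕ} (w : Fin n → ℝ) : ℝ :=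
  ((List.ofFn w).foldl (fun (s : ℝ × ℝ × ℝ) _ =>
    (max s.1 (s.2.2 * topSum s.2.1 (List.ofFn w)), 2 * s.2.1, √(1 / 2) * s.2.2)) (0, 1, 1)).1

section WeakNorm

variable {n : ℕ}

theorem excess_ofFn (l θ : ℝ) (w : Fin n → ℝ) :
    excess l θ (List.ofFn w) = l * θ + ∑ e, max (|w e| - θ) 0 := by
  have h : ∀ (t : List ℝ) (s : ℝ), t.foldl (fun s a => s + max (|a| - θ) 0) s =
      s + (t.map fun a => max (|a| - θ) 0).sum := by
    intro t
    induction t with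
    | nil => simp
    | cons a t ih => intro s; rw [List.foldl_cons, ih, List.map_cons, List.sum_cons, add_assoc]
  rw [excess, h, List.map_ofFn, List.sum_ofFn]
  rfl

theorem foldl_min_spec {γ : Type} (g : γ → ℝ) (t : List γ) (b : ℝ) :
    t.foldl (fun s a => min s (g a)) b ≤ b ∧
      (∀ a ∈ t, t.foldl (fun s a => min s (g a)) b ≤ g a) ∧
      (t.foldl (fun s a => min s (g a)) b = b ∨
        ∃ a ∈ t, t.foldl (fun s a => min s (g a)) b = g a) := by
  induction t generalizing b with
  | nil => simp
  | cons a t ih =>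
    obtain ⟨h1, h2, h3⟩ := ih (min b (g a))
    rw [List.foldl_cons]
    refine ⟨h1.trans (min_le_left _ _), fun x hx => ?_, ?_⟩
    · rcases List.mem_cons.1 hx with rfl | hx
      · exact h1.trans (min_le_right _ _)
      · exact h2 x hx
    · rcases h3 with h3 | ⟨x, hx, h3⟩
      · rcases min_choice b (g a) with h | h
        · exact Or.inl (h3.trans h)
        · exact Or.inr ⟨a, List.mem_cons_self, h3.trans h⟩
      · exact Or.inr ⟨x, List.mem_cons_of_mem _ hx, h3⟩

/-- As a function of `θ`, the excess is convex and linear between its breakpoints. -/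
theorem exists_breakpoint_le {l : ℝ} (hl : 0 < l) (a : Fin n → ℝ) {θ : ℝ} (hθ : 0 ≤ θ) :
    ∃ t, (t = 0 ∨ ∃ e, t = a e) ∧
      l * t + ∑ e, max (a e - t) 0 ≤ l * θ + ∑ e, max (a e - θ) 0 := by
  classical
  set P := Finset.univ.filter fun e => θ < a e with hP
  -- the sum changes linearly at a rate given by the size of `P`
  have hsum : ∀ d : ℝ, ∑ e, (max (a e - θ) 0 + if e ∈ P then d else 0) =
      ∑ e, max (a e - θ) 0 + P.card * d := by
    intro d
    rw [Finset.sum_add_distrib, Finset.sum_ite_mem, Finset.univ_inter, Finset.sum_const,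
      nsmul_eq_mul]
  by_cases hc : l ≤ P.card
  · have hne : P.Nonempty := Finset.card_pos.1 (by exact_mod_cast hl.trans_le hc)
    obtain ⟨e₀, he₀, hmin⟩ := P.exists_min_image a hne
    have hθ₀ : θ < a e₀ := (Finset.mem_filter.1 he₀).2
    refine ⟨a e₀, Or.inr ⟨e₀, rfl⟩, ?_⟩
    have hle : ∑ e, max (a e - a e₀) 0 ≤
        ∑ e, (max (a e - θ) 0 + if e ∈ P then -(a e₀ - θ) else 0) := by
      refine Finset.sum_le_sum fun e _ => ?_
      split_ifs with he
      · have := hmin e he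
        rw [max_eq_left (by linarith), max_eq_left (by linarith)]
        linarith
      · have : a e ≤ θ := by simpa [hP] using he
        rw [max_eq_right (by linarith), max_eq_right (by linarith), add_zero]
    rw [hsum] at hle
    nlinarith
  · obtain ⟨t, ht, ht0, htθ, hat⟩ : ∃ t, (t = 0 ∨ ∃ e, t = a e) ∧ 0 ≤ t ∧ t ≤ θ ∧
        ∀ e ∉ P, a e ≤ t := by
      have hmem : ∀ e, e ∉ P ↔ a e ≤ θ := fun e => by simp [hP]
      by_cases hpos : ∃ e, e ∉ P ∧ 0 ≤ a e
      · obtain ⟨e₀, he₀, hmax⟩ := Pᶜ.exists_max_image a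
          ⟨hpos.choose, Finset.mem_compl.2 hpos.choose_spec.1⟩
        refine ⟨a e₀, Or.inr ⟨e₀, rfl⟩, ?_, (hmem _).1 (Finset.mem_compl.1 he₀),
          fun e he => hmax e (Finset.mem_compl.2 he)⟩
        exact hpos.choose_spec.2.trans (hmax _ (Finset.mem_compl.2 hpos.choose_spec.1))
      · refine ⟨0, Or.inl rfl, le_rfl, hθ, fun e he => ?_⟩
        by_contra h
        exact hpos ⟨e, he, (not_le.1 h).le⟩
    refine ⟨t, ht, ?_⟩
    have hle : ∑ e, max (a e - t) 0 ≤
        ∑ e, (max (a e - θ) 0 + if e ∈ P then θ - t else 0) := by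
      refine Finset.sum_le_sum fun e _ => ?_
      split_ifs with he
      · have : θ < a e := (Finset.mem_filter.1 he).2
        rw [max_eq_left (by linarith), max_eq_left (by linarith)]
        linarith
      · have := hat e he
        rw [max_eq_right (by linarith), max_eq_right (by linarith), add_zero]
    rw [hsum] at hle
    nlinarith [not_le.1 hc]

theorem topSum_le {l : ℝ} (hl : 0 < l) (w : Fin n → ℝ) {θ : ℝ} (hθ : 0 ≤ θ) :
    topSum l (List.ofFn w) ≤ l * θ + ∑ e, max (|w e| - θ) 0 := by
  obtain ⟨t, ht, hle⟩ := exists_breakpoint_le hl (fun e => |w e|) hθ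
  refine le_trans ?_ hle
  rw [← excess_ofFn]
  obtain ⟨h1, h2, -⟩ := foldl_min_spec (fun a => excess l |a| (List.ofFn w)) (List.ofFn w)
    (excess l 0 (List.ofFn w))
  rcases ht with rfl | ⟨e, rfl⟩
  · exact h1
  · exact h2 (w e) ((List.mem_ofFn' _ _).2 ⟨e, rfl⟩)

theorem exists_topSum_eq (l : ℝ) (w : Fin n → ℝ) :
    ∃ θ, 0 ≤ θ ∧ topSum l (List.ofFn w) = l * θ + ∑ e, max (|w e| - θ) 0 := by
  obtain ⟨-, -, h | ⟨a, -, h⟩⟩ := foldl_min_spec (fun a => excess l |a| (List.ofFn w)) (List.ofFn w)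
    (excess l 0 (List.ofFn w))
  · exact ⟨0, le_rfl, h.trans (excess_ofFn _ _ _)⟩
  · exact ⟨|a|, abs_nonneg a, h.trans (excess_ofFn _ _ _)⟩

theorem weakNorm_foldl {γ : Type} (g : ℝ → ℝ) (t : List γ) :
    let s := t.foldl (fun (s : ℝ × ℝ × ℝ) _ =>
      (max s.1 (s.2.2 * g s.2.1), 2 * s.2.1, √(1 / 2) * s.2.2)) (0, 1, 1)
    s.2 = (2 ^ t.length, √(1 / 2) ^ t.length) ∧ 0 ≤ s.1 ∧
      (∀ j < t.length, √(1 / 2) ^ j * g (2 ^ j) ≤ s.1) ∧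
      ∀ B, 0 ≤ B → (∀ j < t.length, √(1 / 2) ^ j * g (2 ^ j) ≤ B) → s.1 ≤ B := by
  induction t using List.reverseRecOn with
  | nil => simp
  | append_singleton t a ih =>
    obtain ⟨h1, h0, h2, h3⟩ := ih
    simp only [List.foldl_append, List.foldl_cons, List.foldl_nil, h1, List.length_append,
      List.length_singleton]
    refine ⟨?_, h0.trans (le_max_left _ _), fun j hj => ?_, fun B hB h => ?_⟩
    · rw [pow_succ', pow_succ']
    · rcases Nat.lt_succ_iff_lt_or_eq.1 hj with hj | rfl
      · exact (h2 j hj).trans (le_max_left _ _)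
      · exact le_max_right _ _
    · exact max_le (h3 B hB fun j hj => h j (by omega)) (h _ (Nat.lt_succ_self _))

theorem le_weakNorm (w : Fin n → ℝ) {j : ℕ} (hj : j < n) :
    √(1 / 2) ^ j * topSum (2 ^ j) (List.ofFn w) ≤ weakNorm w :=
  (weakNorm_foldl (fun l => topSum l (List.ofFn w)) (List.ofFn w)).2.2.1 j (by simpa using hj)

theorem weakNorm_nonneg (w : Fin n → ℝ) : 0 ≤ weakNorm w :=
  (weakNorm_foldl (fun l => topSum l (List.ofFn w)) (List.ofFn w)).2.1

theorem weakNorm_le (w : Fin n → ℝ) {B : ℝ} (hB : 0 ≤ B)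
    (h : ∀ j < n, √(1 / 2) ^ j * topSum (2 ^ j) (List.ofFn w) ≤ B) : weakNorm w ≤ B :=
  (weakNorm_foldl (fun l => topSum l (List.ofFn w)) (List.ofFn w)).2.2.2 B hB
    fun j hj => h j (by simpa using hj)

theorem weakNorm_smul_le (a : ℝ) (w : Fin n → ℝ) : weakNorm (a • w) ≤ |a| * weakNorm w := by
  refine weakNorm_le _ (mul_nonneg (abs_nonneg a) (weakNorm_nonneg w)) fun j hj => ?_
  obtain ⟨θ, hθ, h⟩ := exists_topSum_eq (2 ^ j) w
  have h1 : topSum (2 ^ j) (List.ofFn (a • w)) ≤ |a| * topSum (2 ^ j) (List.ofFn w) := by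
    refine (topSum_le (by positivity) _ (mul_nonneg (abs_nonneg a) hθ)).trans_eq ?_
    rw [h, mul_add, Finset.mul_sum]
    congr 1
    · ring
    · refine Finset.sum_congr rfl fun e _ => ?_
      rw [Pi.smul_apply, smul_eq_mul, abs_mul, ← mul_sub, mul_max_of_nonneg _ _ (abs_nonneg a),
        mul_zero]
  calc _ ≤ √(1 / 2) ^ j * (|a| * topSum (2 ^ j) (List.ofFn w)) := by gcongr
    _ = |a| * (√(1 / 2) ^ j * topSum (2 ^ j) (List.ofFn w)) := by ring
    _ ≤ _ := by gcongr; exact le_weakNorm w hj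

theorem weakNorm_mono {u w : Fin n → ℝ} (h : ∀ e, |u e| ≤ |w e|) : weakNorm u ≤ weakNorm w := by
  refine weakNorm_le _ (weakNorm_nonneg w) fun j hj => le_trans ?_ (le_weakNorm w hj)
  obtain ⟨θ, hθ, h1⟩ := exists_topSum_eq (2 ^ j) w
  gcongr
  rw [h1]
  exact (topSum_le (by positivity) _ hθ).trans (add_le_add le_rfl
    (Finset.sum_le_sum fun e _ => max_le_max (sub_le_sub_right (h e) θ) le_rfl))

theorem weakNorm_comp_le (σ : Equiv.Perm (Fin n)) (w : Fin n → ℝ) :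
    weakNorm (w ∘ σ) ≤ weakNorm w := by
  refine weakNorm_le _ (weakNorm_nonneg w) fun j hj => le_trans ?_ (le_weakNorm w hj)
  obtain ⟨θ, hθ, h1⟩ := exists_topSum_eq (2 ^ j) w
  gcongr
  rw [h1]
  refine (topSum_le (by positivity) _ hθ).trans_eq ?_
  congr 1
  exact Equiv.sum_comp σ fun e => max (|w e| - θ) 0

theorem isSymmMonotoneNorm_weakNorm : IsSymmMonotoneNorm (weakNorm (n := n)) where
  nonneg := weakNorm_nonneg
  eq_zero_iff w := by
    constructor
    · intro h
      funext e
      obtain ⟨θ, hθ, h1⟩ := exists_topSum_eq 1 w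
      have h2 := le_weakNorm w (Nat.zero_lt_of_lt e.2)
      rw [h, pow_zero, pow_zero, one_mul, h1] at h2
      have h3 : max (|w e| - θ) 0 ≤ ∑ e, max (|w e| - θ) 0 :=
        Finset.single_le_sum (f := fun e => max (|w e| - θ) 0) (fun e _ => le_max_right _ _)
          (Finset.mem_univ e)
      have h4 := le_max_left (|w e| - θ) 0
      exact abs_nonpos_iff.1 (by linarith)
    · rintro rfl
      have := weakNorm_smul_le 0 (0 : Fin n → ℝ)
      rw [smul_zero, abs_zero, zero_mul] at this
      exact le_antisymm this (weakNorm_nonneg _)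
  add_le u v := by
    refine weakNorm_le _ (add_nonneg (weakNorm_nonneg u) (weakNorm_nonneg v)) fun j hj => ?_
    refine le_trans ?_ (add_le_add (le_weakNorm u hj) (le_weakNorm v hj))
    obtain ⟨θ, hθ, h1⟩ := exists_topSum_eq (2 ^ j) u
    obtain ⟨η, hη, h2⟩ := exists_topSum_eq (2 ^ j) v
    rw [← mul_add]
    gcongr
    rw [h1, h2]
    refine (topSum_le (by positivity) _ (add_nonneg hθ hη)).trans ?_
    rw [mul_add, add_add_add_comm, ← Finset.sum_add_distrib]
    gcongr with e
    refine max_le ?_ (add_nonneg (le_max_right _ _) (le_max_right _ _))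
    have := abs_add_le (u e) (v e)
    have := le_max_left (|u e| - θ) 0
    have := le_max_left (|v e| - η) 0
    rw [Pi.add_apply]
    linarith
  smul_eq a w := by
    refine le_antisymm (weakNorm_smul_le a w) ?_
    rcases eq_or_ne a 0 with rfl | ha
    · rw [abs_zero, zero_mul]
      exact weakNorm_nonneg _
    · have := weakNorm_smul_le a⁻¹ (a • w)
      rw [inv_smul_smul₀ ha, abs_inv] at this
      rwa [← le_inv_mul_iff₀ (abs_pos.2 ha)]
  mono u v hu huv := weakNorm_mono fun e => by
    rw [abs_of_nonneg (hu e), abs_of_nonneg ((hu e).trans (huv e))]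
    exact huv e
  symm σ w := by
    refine le_antisymm (weakNorm_comp_le σ w) ?_
    have := weakNorm_comp_le σ⁻¹ (w ∘ σ)
    rwa [Function.comp_assoc, ← Equiv.Perm.coe_mul, mul_inv_cancel, Equiv.Perm.coe_one,
      Function.comp_id] at this

theorem sqrt_half_mul_self : √(1 / 2) * √(1 / 2) = (1 / 2 : ℝ) :=
  Real.mul_self_sqrt (by norm_num)

theorem sqrt_half_pos : (0 : ℝ) < √(1 / 2) := Real.sqrt_pos.2 (by norm_num)

theorem sqrt_half_le_one : √(1 / 2) ≤ (1 : ℝ) := Real.sqrt_le_one.2 (by norm_num)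

/-- Many large entries make the norm large. -/
theorem le_weakNorm_of_card {w : Fin n → ℝ} {a : ℝ} {B : Finset (Fin n)} {j : ℕ}
    (hB : 2 ^ j ≤ B.card) (h : ∀ e ∈ B, a ≤ |w e|) :
    √(1 / 2) ^ j * (2 ^ j * a) ≤ weakNorm w := by
  have hj : j < n := by
    have h1 := B.card_le_univ
    rw [Fintype.card_fin] at h1
    exact Nat.lt_two_pow_self.trans_le (hB.trans h1)
  refine le_trans ?_ (le_weakNorm w hj)
  obtain ⟨θ, hθ, h1⟩ := exists_topSum_eq (2 ^ j) w
  gcongr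
  rw [h1]
  have h2 : B.card * max (a - θ) 0 ≤ ∑ e, max (|w e| - θ) 0 := by
    rw [← nsmul_eq_mul]
    refine (Finset.card_nsmul_le_sum B (fun e => max (|w e| - θ) 0) _ fun e he => ?_).trans
      (Finset.sum_le_sum_of_subset_of_nonneg (Finset.subset_univ _) fun e _ _ => le_max_right _ _)
    exact max_le_max (by linarith [h e he]) le_rfl
  have h3 : (2 : ℝ) ^ j * max (a - θ) 0 ≤ B.card * max (a - θ) 0 :=
    mul_le_mul_of_nonneg_right (by exact_mod_cast hB) (le_max_right _ _)
  have h4 : (2 : ℝ) ^ j * (a - θ) ≤ 2 ^ j * max (a - θ) 0 :=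
    mul_le_mul_of_nonneg_left (le_max_left _ _) (by positivity)
  linarith

/-- If at most `2 ^ m` elements have value `√2 ^ (-m)`, for every `m ≥ 1`, then the norm is
bounded. For the sum of the `2 ^ j` largest values take `θ = √2 ^ (-j)`. -/
theorem weakNorm_le_of_card (g : Fin n → ℕ) (D : Finset (Fin n))
    (hD : ∀ m, (D.filter fun e => g e = m).card ≤ 2 ^ m) {v : Fin n → ℝ}
    (hv : ∀ e ∈ D, v e = √(1 / 2) ^ g e) : weakNorm (inducedVec v D) ≤ 7 / 2 := by
  classical
  have hr := sqrt_half_pos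
  refine weakNorm_le _ (by norm_num) fun j _ => ?_
  set r : ℝ := √(1 / 2) with hrdef
  have hrr : r * r = 1 / 2 := sqrt_half_mul_self
  have hterm : ∀ e, max (|inducedVec v D e| - r ^ j) 0 ≤
      ∑ m ∈ Finset.range j, if e ∈ D.filter (fun e => g e = m) then r ^ m else 0 := by
    intro e
    have hnn : 0 ≤ ∑ m ∈ Finset.range j,
        if e ∈ D.filter (fun e => g e = m) then r ^ m else 0 :=
      Finset.sum_nonneg fun m _ => by split_ifs <;> positivity
    refine max_le ?_ hnn
    by_cases he : e ∈ D
    · rw [inducedVec, if_pos he, hv e he, abs_of_pos (by positivity)]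
      by_cases hj : g e < j
      · rw [Finset.sum_eq_single (g e)]
        · rw [if_pos ((Finset.mem_filter (p := fun x => g x = g e)).2 ⟨he, rfl⟩)]
          have : 0 < r ^ j := by positivity
          linarith
        · intro m _ hm
          exact if_neg fun h => hm (Finset.mem_filter.1 h).2.symm
        · exact fun h => absurd (Finset.mem_range.2 hj) h
      · have := pow_le_pow_of_le_one hr.le sqrt_half_le_one (not_lt.1 hj)
        linarith
    · rw [inducedVec, if_neg he, abs_zero]
      have : 0 < r ^ j := by positivity
      linarith
  have hgeom : ∀ j : ℕ, ∑ m ∈ Finset.range j, (2 * r) ^ m ≤ 5 / 2 * (2 * r) ^ j := by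
    intro j
    induction j with
    | zero => norm_num
    | succ j ih =>
      rw [Finset.sum_range_succ, pow_succ]
      have h75 : 7 / 5 ≤ 2 * r := by nlinarith
      nlinarith [pow_pos (by positivity : 0 < 2 * r) j]
  have hsum : ∑ e, max (|inducedVec v D e| - r ^ j) 0 ≤ 5 / 2 * (2 * r) ^ j := by
    refine (Finset.sum_le_sum fun e _ => hterm e).trans ?_
    rw [Finset.sum_comm]
    refine le_trans (Finset.sum_le_sum fun m _ => ?_) (hgeom j)
    rw [Finset.sum_ite_mem, Finset.univ_inter, Finset.sum_const, nsmul_eq_mul, mul_pow]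
    gcongr
    exact_mod_cast hD m
  have h1 := topSum_le (by positivity : (0 : ℝ) < 2 ^ j) (inducedVec v D) (pow_nonneg hr.le j)
  calc r ^ j * topSum (2 ^ j) (List.ofFn (inducedVec v D))
      ≤ r ^ j * (2 ^ j * r ^ j + 5 / 2 * (2 * r) ^ j) := by gcongr; linarith
    _ = 7 / 2 * (2 * (r * r)) ^ j := by rw [mul_pow 2 r, mul_pow 2 (r * r), mul_pow r r]; ring
    _ = 7 / 2 := by rw [hrr]; norm_num

end WeakNorm

namespace PolyComp

variable {ι α : Type} [TreeCode α] {M : Setting ι} {e : ι → α}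

theorem excess {l θ : ι → ℝ} {w : ι → List ℝ} (hlen : PolyBdd M.size fun i => (w i).length)
    (hl : PolyComp M e l) (hθ : PolyComp M e θ) (hw : PolyComp M e w) :
    PolyComp M e fun i => excess (l i) (θ i) (w i) :=
  foldl (g := fun i s a => s + Max.max (|a| - θ i) 0) hlen hw (hl.mul hθ)
    (refl.snd.fst.add ((refl.snd.snd.abs.sub hθ.lift).max (const 0)))

theorem topSum {l : ι → ℝ} {w : ι → List ℝ} (hlen : PolyBdd M.size fun i => (w i).length)
    (hl : PolyComp M e l) (hw : PolyComp M e w) :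
    PolyComp M e fun i => topSum (l i) (w i) :=
  foldl (g := fun i s a => Min.min s (_root_.excess (l i) |a| (w i))) hlen hw
    (excess hlen hl (const 0) hw)
    (refl.snd.fst.min (excess (hlen.comap _) hl.lift refl.snd.snd.abs hw.lift))

theorem weakNorm {n : ι → ℕ} {w : ∀ i, Fin (n i) → ℝ} (hn : PolyBdd M.size n)
    (hw : PolyComp M e fun i => List.ofFn (w i)) :
    PolyComp M e fun i => weakNorm (w i) := by
  have hlen : PolyBdd M.size fun i => (List.ofFn (w i)).length := by simpa using hn
  refine (foldl (b := fun _ => ((0 : ℝ), (1 : ℝ), (1 : ℝ)))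
    (g := fun i s _ => (Max.max s.1 (s.2.2 * _root_.topSum s.2.1 (List.ofFn (w i))), 2 * s.2.1,
      √(1 / 2) * s.2.2)) hlen hw (const _) ?_).fst
  have htop : PolyComp (M.comap fun j : ι × (ℝ × ℝ × ℝ) × ℝ => j.1) (fun j => (e j.1, j.2))
      fun j => _root_.topSum j.2.1.2.1 (List.ofFn (w j.1)) :=
    topSum (hlen.comap _) refl.snd.fst.snd.fst hw.lift
  exact (refl.snd.fst.fst.max (refl.snd.fst.snd.snd.mul htop)).pair
    (((const 2).mul refl.snd.fst.snd.fst).pair ((const _).mul refl.snd.fst.snd.snd))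

end PolyComp

/-! ### Reading bits off a real constant -/

theorem cantorFunction_nonneg (b : ℕ → Bool) : 0 ≤ Cardinal.cantorFunction (1 / 3) b :=
  tsum_nonneg fun _ => Cardinal.cantorFunctionAux_nonneg (by norm_num)

theorem cantorFunction_le_three_halves (b : ℕ → Bool) :
    Cardinal.cantorFunction (1 / 3) b ≤ 3 / 2 := by
  have h1 := Cardinal.cantorFunction_le (c := 1 / 3) (f := b) (g := fun _ => true) (by norm_num)
    (by norm_num) fun _ _ => rfl
  have h2 := Cardinal.cantorFunction_succ (c := 1 / 3) (fun _ => true) (by norm_num) (by norm_num)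
  simp only [cond_true] at h2
  linarith

theorem one_le_cantorFunction_iff (b : ℕ → Bool) :
    1 ≤ Cardinal.cantorFunction (1 / 3) b ↔ b 0 = true := by
  have h := Cardinal.cantorFunction_succ (c := 1 / 3) b (by norm_num) (by norm_num)
  have h0 := cantorFunction_nonneg fun n => b (n + 1)
  have h1 := cantorFunction_le_three_halves fun n => b (n + 1)
  cases hb : b 0 <;> rw [hb] at h <;> simp at h ⊢ <;> linarith

/-- Shifting out the first `l.length` bits, and counting those that are `true`. -/
theorem foldl_cantorFunction (b : ℕ → Bool) {γ : Type} (l : List γ) (s : ℝ) :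
    l.foldl (fun (s : ℝ × ℝ) _ => if 1 ≤ s.1 then (3 * (s.1 - 1), s.2 + 1) else (3 * s.1, s.2))
      (Cardinal.cantorFunction (1 / 3) b, s) =
      (Cardinal.cantorFunction (1 / 3) fun k => b (l.length + k),
        s + ∑ k ∈ Finset.range l.length, if b k then (1 : ℝ) else 0) := by
  induction l using List.reverseRecOn with
  | nil => simp
  | append_singleton l a ih =>
    rw [List.foldl_append, ih, List.foldl_cons, List.foldl_nil, List.length_append,
      List.length_singleton, Finset.sum_range_succ, ← add_assoc]
    have h := Cardinal.cantorFunction_succ (c := 1 / 3) (fun k => b (l.length + k)) (by norm_num)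
      (by norm_num)
    have hb := one_le_cantorFunction_iff fun k => b (l.length + k)
    have hs : (fun k => b (l.length + (k + 1))) = fun k => b (l.length + 1 + k) := by
      funext k
      congr 1
      ring
    rw [← hs]
    simp only [add_zero] at h hb
    by_cases h1 : b l.length = true
    · rw [if_pos (hb.2 h1), h, h1, cond_true, if_pos rfl]
      congr 1
      ring
    · rw [if_neg fun h' => h1 (hb.1 h'), h, Bool.eq_false_iff.2 h1, cond_false, if_neg (by simp)]
      congr 1 <;> ring

/-- The bits that code the numbers `a n ≤ n`, each of them in unary: the bits of `a n` start at
position `n * n`. -/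
def adviceBits (a : ℕ → ℕ) (k : ℕ) : Bool :=
  decide (k - Nat.sqrt k * Nat.sqrt k < a (Nat.sqrt k))

theorem sum_adviceBits {a : ℕ → ℕ} {n : ℕ} (ha : a n ≤ n) :
    ∑ k ∈ Finset.range n, (if adviceBits a (n * n + k) then (1 : ℝ) else 0) = a n := by
  have h : ∀ k ∈ Finset.range n, (if adviceBits a (n * n + k) then (1 : ℝ) else 0) =
      if k ∈ Finset.range (a n) then 1 else 0 := by
    intro k hk
    have hk' := Finset.mem_range.1 hk
    rw [adviceBits, Nat.sqrt_add_eq n (by omega), Nat.add_sub_cancel_left]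
    simp
  rw [Finset.sum_congr rfl h, Finset.sum_ite_mem,
    Finset.inter_eq_right.2 (Finset.range_subset_range.2 ha)]
  simp

namespace PolyComp

variable {ι α β : Type} [TreeCode α] [TreeCode β] {M : Setting ι} {e : ι → α}

/-- An arbitrary function of the length of a list, with values at most its argument; it is coded by
a real constant of the program. -/
theorem advice {γ : Type} [TreeCode γ] {a : ℕ → ℕ} (ha : ∀ n, a n ≤ n) {l : ι → List γ}
    (hlen : PolyBdd M.size fun i => (l i).length) (hl : PolyComp M e l) :
    PolyComp M e fun i => (a (l i).length : ℝ) := by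
  have hstep : ∀ {δ : Type} [TreeCode δ] {κ : Type} {M : Setting κ} {e : κ → (ℝ × ℝ) × δ},
      PolyComp M e fun j => if 1 ≤ (e j).1.1 then (3 * ((e j).1.1 - 1), (e j).1.2 + 1)
        else (3 * (e j).1.1, (e j).1.2) := fun {δ _ κ M e} =>
    ite_le (const 1) refl.fst.fst
      (((const 3).mul (refl.fst.fst.sub (const 1))).pair (refl.fst.snd.add (const 1)))
      (((const 3).mul refl.fst.fst).pair refl.fst.snd)
  have h1 := foldl (b := fun _ => (Cardinal.cantorFunction (1 / 3) (adviceBits a), (0 : ℝ)))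
    (g := fun _ s _ => if 1 ≤ s.1 then (3 * (s.1 - 1), s.2 + 1) else (3 * s.1, s.2))
    (by simp only [List.length_product]; exact hlen.mul hlen)
    (hl.product hlen hlen hl) (const _) (refl.snd.trans hstep)
  have h2 := foldl (b := fun i => (Cardinal.cantorFunction (1 / 3) fun k =>
      adviceBits a ((l i).length * (l i).length + k), (0 : ℝ)))
    (g := fun _ s _ => if 1 ≤ s.1 then (3 * (s.1 - 1), s.2 + 1) else (3 * s.1, s.2))
    hlen hl ((h1.fst.of_eq fun i => by rw [foldl_cantorFunction, List.length_product]).pair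
      (const 0)) (refl.snd.trans hstep)
  refine h2.snd.of_eq fun i => ?_
  rw [foldl_cantorFunction, zero_add, sum_adviceBits (ha _)]

/-- Powers with exponent at most the length of a list. -/
theorem pow {γ : Type} [TreeCode γ] (r : ℝ) {l : ι → List γ} {m : ι → ℕ}
    (hlen : PolyBdd M.size fun i => (l i).length) (hm : ∀ i, m i ≤ (l i).length)
    (hl : PolyComp M e l) (hu : PolyComp M e fun i => (m i : ℝ)) :
    PolyComp M e fun i => r ^ m i := by
  refine (foldl (b := fun _ => ((0 : ℝ), (1 : ℝ)))
    (g := fun i s _ => if s.1 < (m i : ℝ) then (s.1 + 1, r * s.2) else s) hlen hl (const _)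
    (ite refl.snd.fst.fst hu.lift ((refl.snd.fst.fst.add (const 1)).pair
      ((const r).mul refl.snd.fst.snd)) refl.snd.fst)).snd.of_eq fun i => ?_
  have h : ∀ l : List γ, l.foldl (fun (s : ℝ × ℝ) _ =>
      if s.1 < (m i : ℝ) then (s.1 + 1, r * s.2) else s) (0, 1) =
      (((Min.min l.length (m i) : ℕ) : ℝ), r ^ Min.min l.length (m i)) := by
    intro l
    induction l using List.reverseRecOn with
    | nil => simp
    | append_singleton l a ih =>
      rw [List.foldl_append, ih, List.foldl_cons, List.foldl_nil, List.length_append,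
        List.length_singleton]
      by_cases hlt : l.length < m i
      · rw [min_eq_left hlt.le, min_eq_left (Nat.succ_le_of_lt hlt),
          if_pos (show ((l.length : ℕ) : ℝ) < m i by exact_mod_cast hlt), pow_succ']
        push_cast
        rfl
      · rw [min_eq_right (not_lt.1 hlt), min_eq_right (by omega), if_neg (lt_irrefl _)]
  rw [h, min_eq_right (hm i)]

end PolyComp

/-! ### From norms to budgets -/

theorem exists_groupsOf {n : ℕ} (S : Fin (numGroups n) → Finset (Fin n))
    (hS : ∀ i j, i ≠ j → Disjoint (S i) (S j)) :
    ∃ g : Fin n → ℕ, (∀ e, g e ≤ numGroups n) ∧ S = groupsOf g := by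
  classical
  refine ⟨fun e => if h : ∃ i, e ∈ S i then h.choose + 1 else 0, fun e => ?_, ?_⟩
  · dsimp only
    split_ifs with h
    · exact h.choose.2
    · exact Nat.zero_le _
  · funext i
    ext e
    simp only [groupsOf, Finset.mem_filter, Finset.mem_univ, true_and]
    constructor
    · intro he
      have h : ∃ i, e ∈ S i := ⟨i, he⟩
      rw [dif_pos h]
      by_contra hne
      exact Finset.disjoint_left.1 (hS h.choose i fun h' => hne (by rw [h'])) h.choose_spec he
    · intro he
      split_ifs at he with h
      · have : h.choose = i := Fin.ext (by omega)
        exact this ▸ h.choose_spec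

/-- What the reduction has to know about `c`, which need not be computable: `0` if the budgets do
not matter as `n ≤ 47 * c ^ 2`, and else an integer between `7 * c` and `8 * c`. -/
noncomputable def budgetAdvice (c : ℝ) (n : ℕ) : ℕ :=
  open scoped Classical in if (n : ℝ) ≤ 47 * c ^ 2 then 0 else ⌈7 * c⌉₊

theorem ceil_seven_mul_le {c : ℝ} (hc : 1 ≤ c) : (⌈7 * c⌉₊ : ℝ) ≤ 8 * c := by
  have := Nat.ceil_lt_add_one (by linarith : 0 ≤ 7 * c)
  linarith

theorem budgetAdvice_le {c : ℝ} (hc : 1 ≤ c) (n : ℕ) : budgetAdvice c n ≤ n := by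
  unfold budgetAdvice
  split_ifs with h
  · exact Nat.zero_le _
  · have := ceil_seven_mul_le hc
    have h1 : (⌈7 * c⌉₊ : ℝ) ≤ n := by nlinarith
    exact_mod_cast h1

/-- The values for the norm minimization version. The ungrouped elements are too expensive. If the
budgets matter, then the elements of group `i` have value `√2 ^ (-i)`. -/
noncomputable def groupValue {n : ℕ} (a : ℕ) (g : Fin n → ℕ) (e : Fin n) : ℝ :=
  if (g e : ℝ) ≤ 0 then n else if (0 : ℝ) < a then √(1 / 2) ^ g e else 0

theorem groupValue_nonneg {n : ℕ} (a : ℕ) (g : Fin n → ℕ) (e : Fin n) : 0 ≤ groupValue a g e := by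
  have := sqrt_half_pos
  unfold groupValue
  split_ifs <;> positivity

theorem le_weakNorm_of_mem {n : ℕ} {v : Fin n → ℝ} (hv : ∀ e, 0 ≤ v e) {D : Finset (Fin n)}
    {e : Fin n} (he : e ∈ D) : v e ≤ weakNorm (inducedVec v D) := by
  have h := le_weakNorm_of_card (w := inducedVec v D) (a := v e) (B := {e}) (j := 0) (by simp)
    fun a ha => by
      rw [Finset.mem_singleton.1 ha, inducedVec, if_pos he, abs_of_nonneg (hv e)]
  simpa using h

/-- A `1`-valid solution has small norm. -/
theorem mul_weakNorm_le_of_isValidSolution {n : ℕ} {F : Set (Finset (Fin n))} {g : Fin n → ℕ}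
    (hg : ∀ e, g e ≤ numGroups n) {c : ℝ} (hc : 1 ≤ c) {D : Finset (Fin n)}
    (hD : IsValidSolution F (groupsOf g) 1 D) :
    c * weakNorm (inducedVec (groupValue (budgetAdvice c n) g) D) ≤ budgetAdvice c n / 2 := by
  rw [isValidSolution_groupsOf hg] at hD
  obtain ⟨-, hpos, hcard⟩ := hD
  have hnot : ∀ e ∈ D, ¬ (g e : ℝ) ≤ 0 := fun e he => by exact_mod_cast (hpos e he).not_ge
  by_cases h0 : budgetAdvice c n = 0
  · have hzero : inducedVec (groupValue (budgetAdvice c n) g) D = 0 := by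
      funext e
      simp only [inducedVec, Pi.zero_apply]
      split_ifs with he
      · rw [groupValue, if_neg (hnot e he), h0, if_neg (by simp)]
      · rfl
    rw [hzero, isSymmMonotoneNorm_weakNorm.zero, mul_zero]
    positivity
  · have hopt : weakNorm (inducedVec (groupValue (budgetAdvice c n) g) D) ≤ 7 / 2 := by
      refine weakNorm_le_of_card g D (fun m => ?_) fun e he => ?_
      · rcases (D.filter fun e => g e = m).eq_empty_or_nonempty with h1 | ⟨e, he⟩
        · rw [h1]; exact Nat.zero_le _
        · obtain ⟨heD, rfl⟩ := Finset.mem_filter.1 he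
          have h1 := hpos e heD
          have h2 := hcard (g e - 1) (by have := hg e; omega)
          rw [Nat.sub_add_cancel h1, one_mul] at h2
          exact_mod_cast h2
      · rw [groupValue, if_neg (hnot e he), if_pos (by exact_mod_cast Nat.pos_of_ne_zero h0)]
    have h7 : 7 * c ≤ budgetAdvice c n := by
      unfold budgetAdvice at h0 ⊢
      split_ifs at h0 ⊢ with h
      · exact absurd rfl h0
      · exact Nat.le_ceil _
    nlinarith

/-- A feasible set of small norm is a valid solution. -/
theorem isValidSolution_of_weakNorm_le {n : ℕ} {F : Set (Finset (Fin n))} {g : Fin n → ℕ}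
    (hg : ∀ e, g e ≤ numGroups n) {c : ℝ} (hc : 1 ≤ c) {D : Finset (Fin n)} (hD : D ∈ F)
    (h : weakNorm (inducedVec (groupValue (budgetAdvice c n) g) D) ≤ budgetAdvice c n / 2) :
    IsValidSolution F (groupsOf g) (47 * c ^ 2) D := by
  rw [isValidSolution_groupsOf hg]
  have hgrouped : ∀ e ∈ D, 0 < g e := by
    intro e he
    refine Nat.pos_of_ne_zero fun h0 => ?_
    have h1 := (le_weakNorm_of_mem (groupValue_nonneg _ g) he).trans h
    rw [groupValue, h0, Nat.cast_zero, if_pos le_rfl] at h1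
    have h2 : (1 : ℝ) ≤ n := by exact_mod_cast Nat.one_le_of_lt e.2
    have h3 : (budgetAdvice c n : ℝ) ≤ n := by exact_mod_cast budgetAdvice_le hc n
    linarith
  refine ⟨hD, hgrouped, fun i _ => ?_⟩
  by_cases hlarge : (n : ℝ) ≤ 47 * c ^ 2
  · have h1 : ((D.filter fun e => g e = i + 1).card : ℝ) ≤ n := by
      exact_mod_cast (Finset.card_le_univ _).trans_eq (Fintype.card_fin n)
    have h2 : (1 : ℝ) ≤ 2 ^ (i + 1) := one_le_pow₀ one_le_two
    nlinarith
  have ha : budgetAdvice c n = ⌈7 * c⌉₊ := if_neg hlarge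
  have hpos : (0 : ℝ) < budgetAdvice c n := by
    rw [ha]
    exact_mod_cast Nat.ceil_pos.2 (by linarith)
  have hnorm : weakNorm (inducedVec (groupValue (budgetAdvice c n) g) D) ≤ 4 * c := by
    have := ceil_seven_mul_le hc
    rw [ha] at h ⊢
    linarith
  set B := D.filter fun e => g e = i + 1 with hB
  rcases B.eq_empty_or_nonempty with h0 | hne
  · rw [h0, Finset.card_empty, Nat.cast_zero]
    positivity
  set j := Nat.log 2 B.card with hj
  have hj1 : 2 ^ j ≤ B.card := Nat.pow_log_le_self 2 (Finset.card_pos.2 hne).ne'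
  have hj2 : B.card < 2 ^ (j + 1) := Nat.lt_pow_succ_log_self one_lt_two _
  have hr0 : (0 : ℝ) < √(1 / 2) := sqrt_half_pos
  have hlow := (le_weakNorm_of_card (a := √(1 / 2) ^ (i + 1)) hj1 fun e he => by
    obtain ⟨heD, hge⟩ := Finset.mem_filter.1 he
    have hne : ¬ ((i + 1 : ℕ) : ℝ) ≤ 0 := by exact_mod_cast (Nat.succ_pos i).not_ge
    rw [inducedVec, if_pos heD, groupValue, hge, if_neg hne, if_pos hpos,
      abs_of_pos (by positivity)]).trans hnorm
  have hrr : √(1 / 2) * √(1 / 2) = (1 / 2 : ℝ) := sqrt_half_mul_self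
  generalize √(1 / 2) = r at hr0 hlow hrr
  -- squaring removes the square roots
  have hsq : (r ^ j * (2 ^ j * r ^ (i + 1))) ^ 2 ≤ (4 * c) ^ 2 :=
    pow_le_pow_left₀ (by positivity) hlow 2
  have heq : (r ^ j * (2 ^ j * r ^ (i + 1))) ^ 2 = 2 ^ j / 2 ^ (i + 1) := by
    calc (r ^ j * (2 ^ j * r ^ (i + 1))) ^ 2
        = (r * r) ^ j * (r * r) ^ (i + 1) * 2 ^ j * 2 ^ j := by
          rw [mul_pow r r j, mul_pow r r (i + 1)]; ring
      _ = ((1 / 2) * 2) ^ j * 2 ^ j * (1 / 2) ^ (i + 1) := by rw [hrr, mul_pow _ _ j]; ring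
      _ = 2 ^ j / 2 ^ (i + 1) := by
          rw [one_div, inv_mul_cancel₀ two_ne_zero, one_pow, one_mul, inv_pow, div_eq_mul_inv]
  rw [heq, div_le_iff₀ (by positivity)] at hsq
  have hm : (B.card : ℝ) ≤ 2 * 2 ^ j := by
    rw [← pow_succ']
    exact_mod_cast hj2.le
  have : (0 : ℝ) < c ^ 2 * 2 ^ (i + 1) := by positivity
  nlinarith

/-- The inputs of the budgeted version. -/
structure LogBgtInput (Q : SubsetProblem) where
  /-- the instance -/
  x : RTree
  mem : x ∈ Q.instances
  /-- the group numbers -/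
  g : Fin (Q.card x) → ℕ
  le : ∀ e, g e ≤ numGroups (Q.card x)

namespace LogBgtInput

variable {Q : SubsetProblem}

/-- Machines without oracle. -/
def setting (Q : SubsetProblem) : Setting (LogBgtInput Q) :=
  ⟨fun _ => noOracle, fun i => (RTree.pair i.x (RTree.ofVec fun e => (i.g e : ℝ))).size⟩

/-- The input in explicit form. -/
noncomputable def data (i : LogBgtInput Q) : RTree × List ℝ :=
  (i.x, List.ofFn fun e => (i.g e : ℝ))

theorem enc_pair_ofFn {n : ℕ} (x : RTree) (w : Fin n → ℝ) :
    enc (x, List.ofFn w) = .pair x (.ofVec w) :=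
  congrArg (RTree.pair x) (enc_ofFn w)

theorem polyBdd_card : PolyBdd (setting Q).size fun i => Q.card i.x := by
  refine PolyBdd.self.mono fun i => ?_
  simp only [setting, RTree.size, RTree.size_ofVec]
  omega

theorem polyBdd_length : PolyBdd (setting Q).size fun i =>
    (List.ofFn fun e => (i.g e : ℝ)).length := by
  simpa using polyBdd_card

theorem polyComp_groupValue {a : ℕ → ℕ}
    (ha : PolyComp (setting Q) data fun i => (a (Q.card i.x) : ℝ)) :
    PolyComp (setting Q) data fun i => List.ofFn (groupValue (a (Q.card i.x)) i.g) := by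
  have hg : PolyComp (setting Q) data fun i => List.ofFn fun e => (i.g e : ℝ) := PolyComp.refl.snd
  let κ := {j : LogBgtInput Q × ℝ // ∃ e, (j.1.g e : ℝ) = j.2}
  have hu : PolyComp ((setting Q).comap fun j : κ => j.1.1) (fun j => (j.1.1.data, j.1.2))
      fun j => j.1.2 := PolyComp.refl.snd
  have hpow : PolyComp ((setting Q).comap fun j : κ => j.1.1) (fun j => (j.1.1.data, j.1.2))
      fun j => √(1 / 2) ^ ⌊j.1.2⌋₊ := by
    refine PolyComp.pow _ (l := fun j => List.ofFn fun e => (j.1.1.g e : ℝ))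
      (polyBdd_length.comap _) (fun j => ?_) hg.lift (hu.of_eq fun j => ?_)
    · obtain ⟨e, he⟩ := j.2
      rw [← he, Nat.floor_natCast, List.length_ofFn]
      exact (j.1.1.le e).trans (Nat.clog_two_le _)
    · obtain ⟨e, he⟩ := j.2
      rw [← he, Nat.floor_natCast]
  have hlenE : PolyComp ((setting Q).comap fun j : κ => j.1.1) (fun j => (j.1.1.data, j.1.2))
      fun j => ((List.ofFn fun e => (j.1.1.g e : ℝ)).length : ℝ) :=
    (hg.length polyBdd_length).lift
  have h := hg.map_of (g := fun i u => if u ≤ 0 then ((List.ofFn fun e => (i.g e : ℝ)).length : ℝ)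
        else if (0 : ℝ) < a (Q.card i.x) then √(1 / 2) ^ ⌊u⌋₊ else 0)
      (fun i u => ∃ e, (i.g e : ℝ) = u) polyBdd_length (fun i u hu => by simpa using hu)
      (hu.ite_le (.const 0) hlenE (PolyComp.ite (.const 0) ha.lift hpow (.const 0)))
  refine h.of_eq fun i => ?_
  rw [List.map_ofFn]
  congr 1
  funext e
  simp [groupValue]

/-- An approximation algorithm for the norm minimization version can be run on the norm `weakNorm`
without an oracle. -/
theorem polyComp_minNorm {p : RProg} {P : Polynomial ℕ}
    {v : ∀ i : LogBgtInput Q, Fin (Q.card i.x) → ℝ}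
    (hv : PolyComp (setting Q) data fun i => List.ofFn (v i))
    {sol : ∀ i : LogBgtInput Q, Option (Finset (Fin (Q.card i.x)))}
    (hrun : ∀ i, p.RunsWithin (valueOracle (weakNorm (n := Q.card i.x))) P
      (.pair i.x (.ofVec (v i))) (.ofAnswer (sol i))) :
    PolyComp (setting Q) data fun i => (sol i).map indicatorList := by
  have hnorm : PolyComp (ι := Σ n : ℕ, Fin n → ℝ) ⟨fun _ => noOracle, fun j => j.1⟩
      (fun j => List.ofFn j.2) fun j => weakNorm j.2 := PolyComp.weakNorm PolyBdd.self .refl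
  obtain ⟨s, t, ⟨R, hR⟩, hs⟩ := hnorm
  refine (PolyComp.refl.fst.pair hv).trans ⟨p.subst s,
    fun i => P.eval ((setting Q).size i) * (R.eval (Q.card i.x) + 1),
    (PolyBdd.self.eval P).mul ((polyBdd_card.eval R).add (.const 1)), fun i => ?_⟩
  obtain ⟨k, hk, hr⟩ := hrun i
  have hsub := hr.subst (O' := noOracle) (s := s) (B := R.eval (Q.card i.x)) ?_
  · obtain ⟨k', hk', hr'⟩ := hsub
    refine ⟨k', hk'.trans (Nat.mul_le_mul_right _ ?_), ?_⟩
    · simpa only [setting, RTree.size, RTree.size_ofVec] using hk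
    · rw [enc_answer]
      have := enc_pair_ofFn i.x (v i)
      exact this ▸ hr'
  · rintro q a ⟨w, rfl, rfl⟩
    obtain ⟨k, hk, hr⟩ := hs ⟨_, w⟩
    rw [enc_ofFn] at hr
    exact ⟨k, hk.trans (hR ⟨_, w⟩), hr⟩

end LogBgtInput

theorem SubsetProblem.logBgt_of_minNorm (Q : SubsetProblem) (c : ℕ → ℝ) (hc : ∀ n, 1 ≤ c n)
    (h : Q.MinNormPolyTimeApprox c) : Q.LogBgtPolyTime (fun n => 47 * c n ^ 2) fun _ => 1 := by
  obtain ⟨p, P, hp⟩ := h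
  let a : ℕ → ℕ := fun n => budgetAdvice (c n) n
  let v : ∀ i : LogBgtInput Q, Fin (Q.card i.x) → ℝ := fun i => groupValue (a (Q.card i.x)) i.g
  choose sol hsol using fun i : LogBgtInput Q => hp i.x i.mem (v i) (groupValue_nonneg _ _)
    weakNorm isSymmMonotoneNorm_weakNorm
  have hlen := LogBgtInput.polyBdd_length (Q := Q)
  have hg : PolyComp (LogBgtInput.setting Q) LogBgtInput.data fun i =>
      List.ofFn fun e => (i.g e : ℝ) := PolyComp.refl.snd
  have ha : PolyComp (LogBgtInput.setting Q) LogBgtInput.data fun i => (a (Q.card i.x) : ℝ) :=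
    (PolyComp.advice (fun n => budgetAdvice_le (hc n) n) hlen hg).of_eq fun i => by
      rw [List.length_ofFn]
  have hv := LogBgtInput.polyComp_groupValue ha
  have hs := LogBgtInput.polyComp_minNorm hv fun i => (hsol i).1
  have hflag : PolyComp (LogBgtInput.setting Q) LogBgtInput.data fun i =>
      if (sol i).isSome then (1 : ℝ) else 0 :=
    hs.isSome.of_eq fun i => by rw [Option.isSome_map]
  have hind : PolyComp (LogBgtInput.setting Q) LogBgtInput.data fun i =>
      indicatorList ((sol i).getD ∅) := by
    refine (PolyComp.ite (.const 0) hflag hs.getD_nil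
      (hg.map (g := fun _ _ => (0 : ℝ)) hlen (.const 0))).of_eq fun i => ?_
    cases sol i with
    | none => simp [indicatorList, List.map_ofFn, Function.comp_def]
    | some D => simp
  have hnorm : PolyComp (LogBgtInput.setting Q) LogBgtInput.data fun i =>
      weakNorm (inducedVec (v i) ((sol i).getD ∅)) :=
    PolyComp.weakNorm LogBgtInput.polyBdd_card
      ((PolyComp.zipWith (g := fun _ a b => a * b) (by simpa using hlen)
        (fun i => by simp [indicatorList]) hv hind
        (PolyComp.refl.snd.fst.mul PolyComp.refl.snd.snd)).of_eq fun i =>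
          zipWith_indicatorList _ _)
  -- the answer is accepted if its norm is at most half of the advice
  obtain ⟨q, t, ⟨R, hR⟩, hq⟩ := PolyComp.ite (.const 0) hflag
    (PolyComp.ite_le hnorm (ha.mul (.const (1 / 2))) hind.some (.const none)) (.const none)
  refine ⟨q, R, fun x hx S hS => ?_⟩
  obtain ⟨g, hgle, rfl⟩ := exists_groupsOf S hS
  obtain ⟨k, hk, hrun⟩ := hq ⟨x, hx, g, hgle⟩
  have hspec := (hsol ⟨x, hx, g, hgle⟩).2
  have hgi : groupIndex (groupsOf g) = fun e => (g e : ℝ) := funext (groupIndex_groupsOf g hgle)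
  have hkR := hk.trans (hR _)
  rw [hgi]
  rw [LogBgtInput.data, LogBgtInput.enc_pair_ofFn] at hrun
  dsimp only at hrun hspec
  cases hs : sol ⟨x, hx, g, hgle⟩ with
  | none =>
    rw [hs] at hrun hspec
    refine ⟨none, ⟨k, hkR, ?_⟩, fun D hD => ?_⟩
    · rw [if_neg (by simp)] at hrun
      exact hrun
    · have := hD.1
      rw [hspec] at this
      exact this
  | some D =>
    rw [hs] at hrun hspec
    rw [if_pos (by simp)] at hrun
    by_cases hle : weakNorm (inducedVec (v ⟨x, hx, g, hgle⟩) D) ≤ (a (Q.card x) : ℝ) * (1 / 2)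
    · rw [Option.getD_some, if_pos hle] at hrun
      refine ⟨some D, ⟨k, hkR, enc_answer (some D) ▸ hrun⟩, ?_⟩
      exact isValidSolution_of_weakNorm_le hgle (hc _) hspec.1 (hle.trans_eq (by ring))
    · rw [Option.getD_some, if_neg hle] at hrun
      refine ⟨none, ⟨k, hkR, hrun⟩, fun D' hD' => hle ?_⟩
      exact ((hspec.2 D' hD'.1).trans (mul_weakNorm_le_of_isValidSolution hgle (hc _) hD')).trans_eq
        (by ring)

theorem theorem4p1 (Q : SubsetProblem) (hQ : Q.PolyTimeMembership)
    (c : ℕ → ℝ) (hc : ∀ n, 1 ≤ c n) :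
    (Q.LogBgtPolyTime c (fun _ => 1) →
      ∀ ε : ℝ, 0 < ε → Q.MinNormPolyTimeApprox (fun n => 4 * c n + ε)) ∧
    (Q.MinNormPolyTimeApprox c →
      Q.LogBgtPolyTime (fun n => 47 * c n ^ 2) (fun _ => 1)) :=
  ⟨Q.minNorm_of_logBgt hQ c hc, Q.logBgt_of_minNorm c hc⟩
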